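/- **Setting.** Let $M,j_0\ge 0$ be integers, let $\mathcal N$ be a finite set, and let $\mathcal R=\{(m,j): 0\le m\le M,\ j\ge j_0\}$ (phase $m$, level $j$). Consider a continuous-time Markov chain on $\mathcal N\cup\mathcal R$ with transition rates $q(\cdot,\cdot)$ such that: transitions within $\mathcal N$ are arbitrary; transitions between $\mathcal N$ and $\mathcal R$, in either direction, involve only states $(m,j_0)$ of $\mathcal R$ and are otherwise arbitrary; and the only transitions within $\mathcal R$ are $(m,j)\to(m,j+1)$ at rate $\lambda_m\ge 0$, $(m,j)\to(m,j-1)$ at rate $\mu_m\ge 0$ (for $j\ge j_0+1$), and $(m,j)\to(i,j+\Delta)$ at rate $\alpha_m\langle i-m\rangle\langle\Delta\rangle\ge 0$ for $m<i\le M$ and $\Delta\in\{-1,0,1\}$ (for $j+\Delta\ge j_0$). Assume that the chain is ergodic (irreducible and positive recurrent). Put $\alpha_m=\sum_{i=m+1}^M\sum_{\Delta=-1}^1\alpha_m\langle i-m\rangle\langle\Delta\rangle$; for $\lambda_m>0$, $$\phi_m(s)=\frac{s+\lambda_m+\mu_m-\sqrt{(s+\lambda_m+\mu_m)^2-4\lambda_m\mu_m}}{2\lambda_m};$$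 and let the *bases* be $r_m=\frac{\lambda_m}{\mu_m}\phi_m(\alpha_m)$ if $\lambda_m,\mu_m>0$, $r_m=\frac{\lambda_m}{\lambda_m+\alpha_m}$ if $\mu_m=0$, and $r_m=0$ if $\lambda_m=0$. **Theorem.** Assume that the nonzero bases among $r_0,\dots,r_M$ are pairwise distinct, and that $\alpha_i\langle m-i\rangle\langle 1\rangle=0$ for all $i<m\le M$ with $\lambda_i=0$. Then the chain has a limiting probability distribution $\pi$ (that is, $P(X_t=y\mid X_0=x)\to\pi_y$ as $t\to\infty$ for all $x,y$, and $\sum_y\pi_y=1$), and there are constants $c_{m,k}$, $0\le k\le m\le M$, such that $$\pi_{(m,j)}=\sum_{k=0}^m c_{m,k}\,r_k^{\,j-j_0}\qquad(0\le m\le M,\ j\ge j_0+1).$$ Moreover, together with $\{\pi_{(m,j_0)}\}_{0\le m\le M}$ and $\{\pi_x\}_{x\in\mathcal N}$, the $c_{m,k}$ constitute $M(M+5)/2+|\mathcal N|+2$ unknowns satisfying the following system of $M(M+5)/2+|\mathcal N|+3$ linear equations, in which $\pi_{(i,j_0+1)}$ stands for $\sum_{k=0}^i c_{i,k}r_k$: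 - for $0\le k<m\le M$ with $r_m,r_k>0$: $\displaystyle c_{m,k}=\frac{r_kr_m\sum_{i=k}^{m-1}\sum_{\Delta=-1}^1c_{i,k}\,\alpha_i\langle m-i\rangle\langle\Delta\rangle\, r_k^{-\Delta}}{\lambda_m(r_k-r_m)(1-\phi_m(\alpha_m)r_k)}$; - for $0\le k<m\le M$ with $r_k>r_m=0$: $\displaystyle c_{m,k}=\frac{\sum_{i=k}^{m-1}\sum_{\Delta=-1}^1c_{i,k}\,\alpha_i\langle m-i\rangle\langle\Delta\rangle\, r_k^{-\Delta}}{\mu_m(1-r_k)+\alpha_m}$; - for $0\le k<m\le M$ with $r_k=0$: $c_{m,k}=0$; - for $0\le m\le M$: $\displaystyle c_{m,m}=\pi_{(m,j_0)}-\sum_{k=0}^{m-1}c_{m,k}$; - for $0\le m\le M$: $\displaystyle \pi_{(m,j_0)}=\frac{\mu_m\sum_{k=0}^m c_{m,k}r_k+\sum_{x\in\mathcal N}q(x,(m,j_0))\pi_x+\sum_{i=0}^{m-1}\sum_{\Delta=-1}^0\alpha_i\langle m-i\rangle\langle\Delta\rangle\,\pi_{(i,j_0-\Delta)}}{\lambda_m+\sum_{i=m+1}^M\sum_{\Delta=0}^1\alpha_m\langle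 i-m\rangle\langle\Delta\rangle+\sum_{x\in\mathcal N}q((m,j_0),x)}$; - for $x\in\mathcal N$: $\displaystyle \pi_x=\frac{\sum_{m=0}^M q((m,j_0),x)\pi_{(m,j_0)}+\sum_{y\in\mathcal N}q(y,x)\pi_y}{\sum_{m=0}^M q(x,(m,j_0))+\sum_{y\in\mathcal N}q(x,y)}$ (with $q(x,x)=0$); - $\displaystyle 1=\sum_{x\in\mathcal N}\pi_x+\sum_{m=0}^M\sum_{k=0}^m\frac{c_{m,k}}{1-r_k}$. -/

import Mathlib

open Filter Topology
open scoped NNReal ENNReal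

/-! ### Continuous-time Markov chains given by transition rates

`q x y` is the rate of jumping from `x` to `y ≠ x` (diagonal values are not used). The definitions
are meant for chains in which every state has finitely many outgoing transitions and the total
outgoing rates are bounded, as is the case for all chains considered below; then the chain does not
explode and its transition function is the exponential of its generator. -/

namespace CTMC

variable {S : Type*}

open Classical in
/-- The sojourn rate `ν_x = ∑_{y ≠ x} q(x, y)`. -/
noncomputable def sojournRate (q : S → S → ℝ≥0) (x : S) : ℝ≥0 :=
  ∑' y, if y = x then 0 else q x y

open Classical in
/-- The generator: `Q(x, y) = q(x, y)` for `x ≠ y`, and `Q(x, x) = -ν_x`. -/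
noncomputable def generator (q : S → S → ℝ≥0) (x y : S) : ℝ :=
  if y = x then -(sojournRate q x : ℝ) else (q x y : ℝ)

open Classical in
/-- The entries of the powers `Qⁿ` of the generator. -/
noncomputable def generatorPow (q : S → S → ℝ≥0) : ℕ → S → S → ℝ
  | 0 => fun x y => if y = x then 1 else 0
  | n + 1 => fun x y => ∑' z, generator q x z * generatorPow q n z y

/-- The transition function `P_t(x, y) = P(X_t = y | X_0 = x)`, that is, the entries of
`exp (t Q) = ∑ₙ tⁿ Qⁿ / n!`. -/
noncomputable def transition (q : S → S → ℝ≥0) (t : ℝ) (x y : S) : ℝ :=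
  ∑' n : ℕ, t ^ n / (n.factorial : ℝ) * generatorPow q n x y

/-- Every state can be reached from every state through transitions of positive rate. -/
def IsIrreducible (q : S → S → ℝ≥0) : Prop :=
  ∀ x y, Relation.ReflTransGen (fun a b => 0 < q a b) x y

open Classical in
/-- The transition probabilities `q(x, y) / ν_x` of the embedded jump chain. -/
noncomputable def jumpProb (q : S → S → ℝ≥0) (x y : S) : ℝ≥0∞ :=
  if y = x then 0 else (q x y : ℝ≥0∞) / (sojournRate q x : ℝ≥0∞)

open Classical in
/-- `tabooProb q x n y` is the probability that the chain started in `x` is in state `y` after its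
first `n` jumps and has not returned to `x` by then. -/
noncomputable def tabooProb (q : S → S → ℝ≥0) (x : S) : ℕ → S → ℝ≥0∞
  | 0 => fun y => if y = x then 1 else 0
  | n + 1 => fun z => if z = x then 0 else ∑' y, tabooProb q x n y * jumpProb q y z

/-- The expected time until the first return to `x` of the chain started in `x`: the sum over `n`
and `y` of the probability that the chain is in `y` after `n` jumps without having returned,
times the mean `1 / ν_y` of the exponential sojourn time that follows. -/
noncomputable def meanReturnTime (q : S → S → ℝ≥0) (x : S) : ℝ≥0∞ :=
  ∑' n : ℕ, ∑' y, tabooProb q x n y / (sojournRate q y : ℝ≥0∞)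

/-- Ergodicity: irreducible and positive recurrent. -/
structure IsErgodic (q : S → S → ℝ≥0) : Prop where
  irreducible : IsIrreducible q
  positive_recurrent : ∀ x, meanReturnTime q x < ∞

/-- `π` is the limiting probability distribution of the chain: it is a probability distribution,
and `P(X_t = y | X_0 = x) → π_y` as `t → ∞`, whatever the initial state `x`. -/
structure IsLimitingDistribution (q : S → S → ℝ≥0) (π : S → ℝ) : Prop where
  nonneg : ∀ x, 0 ≤ π x
  hasSum_one : HasSum π 1
  tendsto : ∀ x y, Tendsto (fun t : ℝ => transition q t x y) atTop (𝓝 (π y))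

end CTMC

/-! ### Chains that are skip-free in level and unidirectional in phase -/

/-- The transition rates of a chain with nonrepeating portion `N`, phases `0, …, M`, and levels
`j ≥ j₀` (the rates themselves do not involve `j₀`). -/
structure QBDRates (N : Type*) (M : ℕ) where
  /-- `lam m = λ_m`, the rate `(m, j) → (m, j + 1)` -/
  lam : Fin (M + 1) → ℝ≥0
  /-- `mu m = μ_m`, the rate `(m, j) → (m, j - 1)` for `j ≥ j₀ + 1` -/
  mu : Fin (M + 1) → ℝ≥0
  /-- `alpha m i Δ = α_m⟨i - m⟩⟨Δ⟩`, the rate `(m, j) → (i, j + Δ)`; only the values with `m < i`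
  and `Δ ∈ {-1, 0, 1}` are used -/
  alpha : Fin (M + 1) → Fin (M + 1) → ℤ → ℝ≥0
  /-- rates between nonrepeating states -/
  rateNN : N → N → ℝ≥0
  /-- there are no transitions from a state to itself -/
  rateNN_self : ∀ x, rateNN x x = 0
  /-- `rateNR x m` is the rate `x → (m, j₀)` -/
  rateNR : N → Fin (M + 1) → ℝ≥0
  /-- `rateRN m x` is the rate `(m, j₀) → x` -/
  rateRN : Fin (M + 1) → N → ℝ≥0

/-- The state space: the nonrepeating states, and the states `(m, j)` with `0 ≤ m ≤ M`,
`j ≥ j₀`. -/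
abbrev QBDState (N : Type*) (M j₀ : ℕ) : Type _ := N ⊕ Fin (M + 1) × {j : ℕ // j₀ ≤ j}

namespace QBDRates

variable {N : Type*} {M : ℕ}

/-- The transition rates `q(x, y)` of the chain. -/
noncomputable def rate (C : QBDRates N M) (j₀ : ℕ) : QBDState N M j₀ → QBDState N M j₀ → ℝ≥0
  | Sum.inl x, Sum.inl y => C.rateNN x y
  | Sum.inl x, Sum.inr (m, j) => if j.1 = j₀ then C.rateNR x m else 0
  | Sum.inr (m, j), Sum.inl x => if j.1 = j₀ then C.rateRN m x else 0
  | Sum.inr (m, j), Sum.inr (i, l) =>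
      if m = i then
        if l.1 = j.1 + 1 then C.lam m else if l.1 + 1 = j.1 then C.mu m else 0
      else if m < i ∧ ((l.1 : ℤ) - (j.1 : ℤ)) ∈ Finset.Icc (-1 : ℤ) 1 then
        C.alpha m i ((l.1 : ℤ) - (j.1 : ℤ))
      else 0

/-- `α_m`, the total rate of leaving phase `m` from a state of level at least `j₀ + 1`. -/
noncomputable def alphaTot (C : QBDRates N M) (m : Fin (M + 1)) : ℝ :=
  ∑ i ∈ Finset.Ioi m, ∑ Δ ∈ Finset.Icc (-1 : ℤ) 1, (C.alpha m i Δ : ℝ)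

/-- `φ_m(s)`, the Laplace transform of the M/M/1 busy period (used only if `λ_m > 0`). -/
noncomputable def phi (C : QBDRates N M) (m : Fin (M + 1)) (s : ℝ) : ℝ :=
  (s + C.lam m + C.mu m - √((s + C.lam m + C.mu m) ^ 2 - 4 * C.lam m * C.mu m)) / (2 * C.lam m)

/-- The bases `r_m`. -/
noncomputable def base (C : QBDRates N M) (m : Fin (M + 1)) : ℝ :=
  if 0 < C.mu m then (C.lam m : ℝ) / C.mu m * C.phi m (C.alphaTot m)
  else (C.lam m : ℝ) / (C.lam m + C.alphaTot m)

end QBDRates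

/-! ### The linear system -/

namespace CAP

/-- The unknowns: `c_{m,k}` for `k ≤ m`, then `π_{(m,j₀)}`, then `π_x` for `x ∈ N`. -/
abbrev Unknown (N : Type*) (M : ℕ) : Type _ :=
  {p : Fin (M + 1) × Fin (M + 1) // p.2 ≤ p.1} ⊕ Fin (M + 1) ⊕ N

/-- The equations: one for each `c_{m,k}` with `k < m`, one for each `c_{m,m}`, one for each
`π_{(m,j₀)}`, one for each `π_x` with `x ∈ N`, and the normalization. -/
inductive Equation (N : Type*) (M : ℕ)
  | offDiag (m k : Fin (M + 1)) (h : k < m)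
  | diag (m : Fin (M + 1))
  | level (m : Fin (M + 1))
  | nonrep (x : N)
  | norm

variable {N : Type*} {M : ℕ}

/-- The unknown `c_{m,k}`, as a linear functional on assignments of values to the unknowns (zero
unless `k ≤ m`). -/
noncomputable def cVar (N : Type*) {M : ℕ} (m k : Fin (M + 1)) : (Unknown N M → ℝ) →ₗ[ℝ] ℝ :=
  if h : k ≤ m then LinearMap.proj (Sum.inl ⟨(m, k), h⟩) else 0

/-- The unknown `π_{(m,j₀)}`. -/
def levelVar (N : Type*) {M : ℕ} (m : Fin (M + 1)) : (Unknown N M → ℝ) →ₗ[ℝ] ℝ :=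
  LinearMap.proj (Sum.inr (Sum.inl m))

/-- The unknown `π_x`. -/
def nonrepVar (M : ℕ) (x : N) : (Unknown N M → ℝ) →ₗ[ℝ] ℝ :=
  LinearMap.proj (Sum.inr (Sum.inr x))

/-- `∑_{i=k}^{m-1} ∑_{Δ=-1}^{1} c_{i,k} α_i⟨m - i⟩⟨Δ⟩ r_k^{-Δ}`. -/
noncomputable def inflow (C : QBDRates N M) (m k : Fin (M + 1)) : (Unknown N M → ℝ) →ₗ[ℝ] ℝ :=
  ∑ i ∈ Finset.Ico k m, ∑ Δ ∈ Finset.Icc (-1 : ℤ) 1,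
    ((C.alpha i m Δ : ℝ) * C.base k ^ (-Δ)) • cVar N i k

/-- `∑_{k=0}^{m} c_{m,k} r_k`, the expression for `π_{(m,j₀+1)}` in the unknowns. -/
noncomputable def nextLevel (C : QBDRates N M) (m : Fin (M + 1)) : (Unknown N M → ℝ) →ₗ[ℝ] ℝ :=
  ∑ k ∈ Finset.Iic m, C.base k • cVar N m k

/-- The left-hand sides of the equations. -/
noncomputable def lhs : Equation N M → (Unknown N M → ℝ) →ₗ[ℝ] ℝ
  | .offDiag m k _ => cVar N m k
  | .diag m => cVar N m m
  | .level m => levelVar N m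
  | .nonrep x => nonrepVar M x
  | .norm => 0

/-- The constant terms: the left-hand side of the normalization equation is the constant `1`. -/
def const : Equation N M → ℝ
  | .norm => 1
  | _ => 0

/-- The right-hand sides of the equations. -/
noncomputable def rhs [Fintype N] (C : QBDRates N M) :
    Equation N M → (Unknown N M → ℝ) →ₗ[ℝ] ℝ
  | .offDiag m k _ =>
      if C.base k = 0 then 0
      else if C.base m = 0 then
        ((C.mu m : ℝ) * (1 - C.base k) + C.alphaTot m)⁻¹ • inflow C m k
      else
        (C.base k * C.base m /
          (C.lam m * (C.base k - C.base m) * (1 - C.phi m (C.alphaTot m) * C.base k))) •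
          inflow C m k
  | .diag m => levelVar N m - ∑ k ∈ Finset.Iio m, cVar N m k
  | .level m =>
      ((C.lam m : ℝ)
        + ∑ i ∈ Finset.Ioi m, ∑ Δ ∈ Finset.Icc (0 : ℤ) 1, (C.alpha m i Δ : ℝ)
        + ∑ x, (C.rateRN m x : ℝ))⁻¹ •
      ((C.mu m : ℝ) • nextLevel C m
        + ∑ x, (C.rateNR x m : ℝ) • nonrepVar M x
        + ∑ i ∈ Finset.Iio m,
            ((C.alpha i m (-1) : ℝ) • nextLevel C i + (C.alpha i m 0 : ℝ) • levelVar N i))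
  | .nonrep x =>
      (∑ m, (C.rateNR x m : ℝ) + ∑ y, (C.rateNN x y : ℝ))⁻¹ •
      (∑ m, (C.rateRN m x : ℝ) • levelVar N m + ∑ y, (C.rateNN y x : ℝ) • nonrepVar M y)
  | .norm =>
      ∑ x, nonrepVar M x
        + ∑ m : Fin (M + 1), ∑ k ∈ Finset.Iic m, (1 - C.base k)⁻¹ • cVar N m k

/-- The values `v` of the unknowns satisfy the system of linear equations. -/
def IsSolution [Fintype N] (C : QBDRates N M) (v : Unknown N M → ℝ) : Prop :=
  ∀ e : Equation N M, lhs e v + const e = rhs C e v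

/-- The values of the unknowns given by constants `c_{m,k}` and a distribution `π`. -/
def values {j₀ : ℕ} (c : Fin (M + 1) → Fin (M + 1) → ℝ) (π : QBDState N M j₀ → ℝ) :
    Unknown N M → ℝ
  | Sum.inl p => c p.1.1 p.1.2
  | Sum.inr (Sum.inl m) => π (Sum.inr (m, ⟨j₀, le_rfl⟩))
  | Sum.inr (Sum.inr x) => π (Sum.inl x)

end CAP

/-!
The proof has two independent halves.

*Existence of the limiting distribution.* The expected times `CTMC.occupation` spent in the states
before the first return to a fixed state `x₀` have a finite sum, and they balance the flows into and
out of each state: away from `x₀` by the recursion for the taboo probabilities, and at `x₀` because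
total inflow equals total outflow. Normalized, they give a positive stationary distribution `π`
(`CTMC.IsErgodic.exists_isStationary`). As the sojourn rates are bounded by some `Λ`, the transition
function is the average of the powers of the stochastic matrix `P = 1 + Q / Λ` with Poisson weights
of mean `t Λ` (`CTMC.IsUniformizable.transition_eq`), so it suffices that `Pⁿ(x, y) → π_y`
(`CTMC.IsStochastic.tendsto_kernelOp_pow`). This is an energy argument: for bounded `f`, the energies
`∑ π_x (Pⁿf)(x)²` decrease, the loss in each step is the `π`-mean of the variance of `Pⁿf` under
`P(x, ·)`, and therefore these variances tend to `0`. Since `P(x, x) > 0`, the differences of `Pⁿf`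
along transitions tend to `0`, by irreducibility all its differences do, and its `π`-mean stays
constant.

*The form of `π`.* In phase `m`, the balance equations above the lowest level are a second-order
linear recurrence in the level, whose inhomogeneity is the inflow from lower phases. Its
characteristic polynomial has the roots `r_m` and `1 / φ_m(α_m) ≥ 1`
(`QBDRates.charPoly_mul_base`). By induction on `m`, the inflow is a combination of powers of the
`r_k`, `k < m`, for which the `c_{m,k}` give a particular solution. What remains is a null solution
of the homogeneous recurrence, hence a multiple of `r_m^n` (`eq_pow_mul_of_recurrence`,
`QBDRates.eq_sum_coeff`). All bases are less than `1`, because a phase without exits drifts downwards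
(`QBDRates.isStable`). The remaining equations of the linear system are the balance equations at the
lowest level and of the nonrepeating states, and the normalization of `π`.
-/

/-! ### Stationary distributions from mean return times -/

namespace ENNReal

/-- Two families with the same finite sum that agree off `z` agree at `z`. -/
theorem eq_of_tsum_eq {S : Type*} {f g : S → ℝ≥0∞} {z : S} (hfg : ∀ w, w ≠ z → f w = g w)
    (hsum : ∑' w, f w = ∑' w, g w) (hfin : ∑' w, g w ≠ ∞) : f z = g z := by
  classical
  rw [tsum_eq_add_tsum_ite z] at hfin
  rw [tsum_eq_add_tsum_ite z, tsum_eq_add_tsum_ite (f := g) z] at hsum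
  have hrest : ∑' w, (if w = z then 0 else f w) = ∑' w, if w = z then 0 else g w :=
    tsum_congr fun w => by split_ifs with hw; exacts [rfl, hfg w hw]
  rw [hrest] at hsum
  exact (ENNReal.add_left_inj (ne_top_of_le_ne_top hfin le_add_self)).1 hsum

theorem hasSum_toReal_of_tsum_eq {S : Type*} {f : S → ℝ≥0∞} {a : ℝ≥0∞} (hsum : ∑' w, f w = a)
    (ha : a ≠ ∞) : HasSum (fun w => (f w).toReal) a.toReal := by
  subst hsum
  rw [ENNReal.tsum_toReal_eq fun w => ne_top_of_le_ne_top ha (ENNReal.le_tsum w)]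
  exact ENNReal.hasSum_toReal ha

end ENNReal

namespace CTMC

variable {S : Type*} {q : S → S → ℝ≥0} {Λ : ℝ≥0}

theorem sojournRate_eq_tsum (hq : ∀ x, q x x = 0) (x : S) : sojournRate q x = ∑' y, q x y := by
  unfold sojournRate
  refine tsum_congr fun y => ?_
  split_ifs with hy
  · rw [hy, hq]
  · rfl

/-- Every state has finitely many outgoing transitions, and all sojourn rates are below `Λ`. The
inequality is strict so that the uniformized chain with rate `Λ` stays in each state with positive
probability, which makes it aperiodic. -/
structure IsUniformizable (q : S → S → ℝ≥0) (Λ : ℝ≥0) : Prop where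
  diag : ∀ x, q x x = 0
  finite_support : ∀ x, (Function.support (q x)).Finite
  sojournRate_lt : ∀ x, sojournRate q x < Λ

namespace IsUniformizable

theorem summable_rate (h : IsUniformizable q Λ) (x : S) : Summable (q x) :=
  summable_of_hasFiniteSupport (h.finite_support x)

theorem sojournRate_eq (h : IsUniformizable q Λ) (x : S) : sojournRate q x = ∑' y, q x y :=
  sojournRate_eq_tsum h.diag x

theorem hasSum_rate (h : IsUniformizable q Λ) (x : S) :
    HasSum (fun y => (q x y : ℝ)) (sojournRate q x) := by
  rw [h.sojournRate_eq]
  exact_mod_cast (h.summable_rate x).hasSum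

theorem ennreal_tsum_rate (h : IsUniformizable q Λ) (x : S) :
    ∑' y, (q x y : ℝ≥0∞) = sojournRate q x := by
  rw [h.sojournRate_eq, ENNReal.coe_tsum (h.summable_rate x)]

theorem rate_le_sojournRate (h : IsUniformizable q Λ) (x y : S) : q x y ≤ sojournRate q x := by
  rw [h.sojournRate_eq]
  exact (h.summable_rate x).le_tsum y fun _ _ => zero_le

theorem sojournRate_pos [Nontrivial S] (h : IsUniformizable q Λ) (hirr : IsIrreducible q) (x : S) :
    0 < sojournRate q x := by
  obtain ⟨y, hy⟩ := exists_ne x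
  rcases Relation.ReflTransGen.cases_head (hirr x y) with hxy | ⟨z, hz, -⟩
  · exact absurd hxy.symm hy
  · exact hz.trans_le (h.rate_le_sojournRate x z)

end IsUniformizable

/-- The expected time spent in `y` before the first return to `x₀`. -/
noncomputable def occupation (q : S → S → ℝ≥0) (x₀ y : S) : ℝ≥0∞ :=
  ∑' n, tabooProb q x₀ n y / (sojournRate q y : ℝ≥0∞)

theorem tsum_occupation (q : S → S → ℝ≥0) (x₀ : S) :
    ∑' y, occupation q x₀ y = meanReturnTime q x₀ :=
  ENNReal.tsum_comm

section Occupation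

variable [Nontrivial S] (h : IsUniformizable q Λ) (hirr : IsIrreducible q) (x₀ : S)
include h hirr

theorem occupation_mul_sojournRate (y : S) :
    occupation q x₀ y * sojournRate q y = ∑' n, tabooProb q x₀ n y := by
  have hy : (sojournRate q y : ℝ≥0∞) ≠ 0 := by
    exact_mod_cast (h.sojournRate_pos hirr y).ne'
  simp only [occupation, div_eq_mul_inv]
  rw [ENNReal.tsum_mul_right, mul_assoc, ENNReal.inv_mul_cancel hy ENNReal.coe_ne_top, mul_one]

omit [Nontrivial S] hirr in
theorem occupation_mul_rate (y z : S) :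
    occupation q x₀ y * q y z = ∑' n, tabooProb q x₀ n y * jumpProb q y z := by
  by_cases hzy : z = y
  · simp [jumpProb, hzy, h.diag]
  · simp only [occupation, jumpProb, hzy, if_false, div_eq_mul_inv]
    rw [ENNReal.tsum_mul_right, ENNReal.tsum_mul_right]
    ring

/-- Off `x₀`, the balance of flows is the recursion for the taboo probabilities. -/
theorem tsum_occupation_mul_rate_of_ne {z : S} (hz : z ≠ x₀) :
    ∑' y, occupation q x₀ y * q y z = occupation q x₀ z * sojournRate q z := by
  rw [occupation_mul_sojournRate h hirr, tsum_eq_zero_add' ENNReal.summable]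
  simp only [occupation_mul_rate h]
  rw [ENNReal.tsum_comm]
  simp [tabooProb, hz]

/-- The total flow into all states equals the total flow out of all states. As inflow and outflow
agree at every `z ≠ x₀`, they also agree at `x₀`. -/
theorem tsum_occupation_mul_rate (hrec : meanReturnTime q x₀ < ∞) (z : S) :
    ∑' y, occupation q x₀ y * q y z = occupation q x₀ z * sojournRate q z := by
  by_cases hz : z = x₀
  · subst hz
    have htot : ∑' w, ∑' y, occupation q z y * q y w =
        ∑' w, occupation q z w * sojournRate q w := by
      rw [ENNReal.tsum_comm]
      refine tsum_congr fun y => ?_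
      rw [ENNReal.tsum_mul_left, h.ennreal_tsum_rate]
    have hfin : ∑' w, occupation q z w * sojournRate q w ≠ ∞ := by
      refine ne_top_of_le_ne_top (b := meanReturnTime q z * Λ) (by finiteness) ?_
      rw [← tsum_occupation, ← ENNReal.tsum_mul_right]
      refine ENNReal.tsum_le_tsum fun y => ?_
      gcongr
      exact (h.sojournRate_lt y).le
    exact ENNReal.eq_of_tsum_eq (fun w hw => tsum_occupation_mul_rate_of_ne h hirr z hw) htot hfin
  · exact tsum_occupation_mul_rate_of_ne h hirr x₀ hz

end Occupation

/-- A positive stationary probability distribution: the flow into each state equals the flow out. -/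
structure IsStationary (q : S → S → ℝ≥0) (π : S → ℝ) : Prop where
  pos : ∀ x, 0 < π x
  hasSum_one : HasSum π 1
  balance : ∀ y, HasSum (fun x => π x * q x y) (π y * sojournRate q y)

theorem IsErgodic.exists_isStationary [Nontrivial S] (h : IsUniformizable q Λ)
    (herg : IsErgodic q) : ∃ π, IsStationary q π := by
  obtain ⟨x₀⟩ : Nonempty S := inferInstance
  set Z := meanReturnTime q x₀ with hZdef
  have hZtop : Z ≠ ∞ := (herg.positive_recurrent x₀).ne
  have hirr := herg.irreducible
  have hx₀ : occupation q x₀ x₀ ≠ 0 := by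
    intro h0
    have h1 := occupation_mul_sojournRate h hirr x₀ x₀
    rw [h0, zero_mul, eq_comm, ENNReal.tsum_eq_zero] at h1
    simpa [tabooProb] using h1 0
  have hZ0 : Z ≠ 0 := by
    intro h0
    rw [hZdef, ← tsum_occupation, ENNReal.tsum_eq_zero] at h0
    exact hx₀ (h0 x₀)
  have hsum : ∑' y, occupation q x₀ y / Z = 1 := by
    simp only [div_eq_mul_inv]
    rw [ENNReal.tsum_mul_right, tsum_occupation, ENNReal.mul_inv_cancel hZ0 hZtop]
  have hbal (z : S) : ∑' y, occupation q x₀ y / Z * q y z =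
      occupation q x₀ z / Z * sojournRate q z := by
    have := tsum_occupation_mul_rate h hirr x₀ (herg.positive_recurrent x₀) z
    rw [div_eq_mul_inv, mul_right_comm, ← this, ← ENNReal.tsum_mul_right]
    refine tsum_congr fun y => ?_
    rw [div_eq_mul_inv, mul_right_comm]
  have hle (y : S) : occupation q x₀ y / Z ≤ 1 := hsum ▸ ENNReal.le_tsum y
  have hbal' (y : S) : HasSum (fun x => (occupation q x₀ x / Z).toReal * q x y)
      ((occupation q x₀ y / Z).toReal * sojournRate q y) := by
    simpa only [ENNReal.toReal_mul, ENNReal.coe_toReal] using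
      ENNReal.hasSum_toReal_of_tsum_eq (hbal y)
        (ENNReal.mul_ne_top (ne_top_of_le_ne_top ENNReal.one_ne_top (hle y)) ENNReal.coe_ne_top)
  have hx₀pos : 0 < (occupation q x₀ x₀ / Z).toReal :=
    ENNReal.toReal_pos (ENNReal.div_pos hx₀ hZtop).ne'
      (ne_top_of_le_ne_top ENNReal.one_ne_top (hle x₀))
  refine ⟨fun y => (occupation q x₀ y / Z).toReal, fun y => ?_, ?_, hbal'⟩
  · induction hirr x₀ y with
    | refl => exact hx₀pos
    | @tail y z _ hyz ih =>
      have h1 := le_hasSum (hbal' z) y fun _ _ => by positivity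
      have h2 : 0 < (occupation q x₀ y / Z).toReal * q y z := mul_pos ih (by exact_mod_cast hyz)
      exact pos_of_mul_pos_left (h2.trans_le h1) (NNReal.coe_nonneg _)
  · exact ENNReal.hasSum_toReal_of_tsum_eq hsum ENNReal.one_ne_top
end CTMC

/-! ### Convergence of discrete-time chains -/

namespace CTMC

variable {S : Type*}

/-- The action `f ↦ (x ↦ ∑_y K(x, y) f(y))` of a matrix with finitely supported rows on all
functions. -/
noncomputable def kernelOp (K : S → S → ℝ) (hK : ∀ x, (Function.support (K x)).Finite) :
    Module.End ℝ (S → ℝ) where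
  toFun f x := ∑' y, K x y * f y
  map_add' f g := by
    have hs (f : S → ℝ) (x : S) : Summable fun y => K x y * f y :=
      summable_of_hasFiniteSupport ((hK x).subset (Function.support_mul_subset_left _ _))
    funext x
    simp only [Pi.add_apply, mul_add]
    exact (hs f x).tsum_add (hs g x)
  map_smul' c f := by
    funext x
    simp only [Pi.smul_apply, smul_eq_mul, RingHom.id_apply, mul_left_comm _ c]
    exact tsum_mul_left

theorem hasSum_kernelOp (K : S → S → ℝ) (hK) (f : S → ℝ) (x : S) :
    HasSum (fun y => K x y * f y) (kernelOp K hK f x) :=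
  (summable_of_hasFiniteSupport ((hK x).subset (Function.support_mul_subset_left _ _))).hasSum

/-- A transition matrix in which every state has finitely many successors. -/
structure IsStochastic (P : S → S → ℝ) : Prop where
  nonneg : ∀ x y, 0 ≤ P x y
  hasSum_one : ∀ x, HasSum (P x) 1
  finite_support : ∀ x, (Function.support (P x)).Finite

namespace IsStochastic

variable {P : S → S → ℝ} (hP : IsStochastic P)
include hP

theorem abs_kernelOp_le {f : S → ℝ} {B : ℝ} (hf : ∀ y, |f y| ≤ B) (x : S) :
    |kernelOp P hP.finite_support f x| ≤ B := by
  have h1 := hasSum_kernelOp P hP.finite_support f x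
  have h2 : HasSum (fun y => P x y * B) (1 * B) := (hP.hasSum_one x).mul_right B
  rw [one_mul] at h2
  refine abs_le.2 ⟨?_, ?_⟩
  · exact hasSum_le (fun y => by nlinarith [hP.nonneg x y, (abs_le.1 (hf y)).1]) h2.neg h1
  · exact hasSum_le (fun y => by nlinarith [hP.nonneg x y, (abs_le.1 (hf y)).2]) h1 h2

theorem abs_kernelOp_pow_le {f : S → ℝ} {B : ℝ} (hf : ∀ y, |f y| ≤ B) (n : ℕ) (x : S) :
    |(kernelOp P hP.finite_support ^ n) f x| ≤ B := by
  induction n generalizing x with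
  | zero => exact hf x
  | succ n ih =>
    rw [pow_succ']
    exact hP.abs_kernelOp_le ih x

/-- The variance of `f` under `P(x, ·)` dominates the contribution of each single `y`. -/
theorem mul_sq_le_variance (f : S → ℝ) (x y : S) :
    P x y * (f y - kernelOp P hP.finite_support f x) ^ 2 ≤
      kernelOp P hP.finite_support (fun z => f z ^ 2) x -
        kernelOp P hP.finite_support f x ^ 2 := by
  set a := kernelOp P hP.finite_support f x
  have h1 := hasSum_kernelOp P hP.finite_support (fun z => f z ^ 2) x
  have h2 := (hasSum_kernelOp P hP.finite_support f x).mul_left (2 * a)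
  have h3 := (hP.hasSum_one x).mul_left (a ^ 2)
  have h4 := (h1.sub h2).add h3
  have h5 : HasSum (fun z => P x z * (f z - a) ^ 2)
      (kernelOp P hP.finite_support (fun z => f z ^ 2) x - a ^ 2) := by
    have e1 : (fun z => P x z * (f z - a) ^ 2) =
        fun z => P x z * f z ^ 2 - 2 * a * (P x z * f z) + a ^ 2 * P x z := by
      funext z; ring
    have e2 (b : ℝ) : b - a ^ 2 = b - 2 * a * a + a ^ 2 * 1 := by ring
    rw [e1, e2]
    exact h4
  exact le_hasSum h5 y fun z _ => mul_nonneg (hP.nonneg x z) (sq_nonneg _)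

variable {π : S → ℝ} (hπ : ∀ x, 0 < π x) (hπ1 : HasSum π 1)
  (hinv : ∀ y, HasSum (fun x => π x * P x y) (π y))
include hπ hπ1

omit hP in
theorem _root_.CTMC.summable_mul_of_bounded {f : S → ℝ} {B : ℝ} (hf : ∀ y, |f y| ≤ B) :
    Summable fun x => π x * f x := by
  refine Summable.of_norm_bounded (hπ1.summable.mul_right B) fun x => ?_
  rw [norm_mul, Real.norm_of_nonneg (hπ x).le]
  exact mul_le_mul_of_nonneg_left (hf x) (hπ x).le

include hinv

/-- The mean under a stationary distribution is preserved by the chain. -/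
theorem hasSum_mul_kernelOp {f : S → ℝ} {B : ℝ} (hf : ∀ y, |f y| ≤ B) :
    HasSum (fun x => π x * kernelOp P hP.finite_support f x) (∑' y, π y * f y) := by
  have hjoint : Summable fun p : S × S => π p.1 * P p.1 p.2 := by
    refine (summable_prod_of_nonneg
      (fun p => mul_nonneg (hπ p.1).le (hP.nonneg p.1 p.2))).2 ⟨fun x => ?_, ?_⟩
    · exact (hP.hasSum_one x).summable.mul_left (π x)
    · refine hπ1.summable.congr fun x => ?_
      change π x = ∑' y, π x * P x y
      rw [tsum_mul_left, (hP.hasSum_one x).tsum_eq, mul_one]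
  have hsum : Summable fun p : S × S => π p.1 * P p.1 p.2 * f p.2 := by
    refine Summable.of_norm_bounded (hjoint.mul_right B) fun p => ?_
    have h0 := mul_nonneg (hπ p.1).le (hP.nonneg p.1 p.2)
    rw [norm_mul, Real.norm_of_nonneg h0]
    exact mul_le_mul_of_nonneg_left (hf p.2) h0
  have h1 : HasSum (fun x => π x * kernelOp P hP.finite_support f x)
      (∑' p : S × S, π p.1 * P p.1 p.2 * f p.2) := by
    refine hsum.hasSum.prod_fiberwise fun x => ?_
    simpa only [mul_assoc] using (hasSum_kernelOp P hP.finite_support f x).mul_left (π x)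
  have h2 : HasSum (fun y => π y * f y) (∑' p : S × S, π p.1 * P p.1 p.2 * f p.2) := by
    have hswap := (Equiv.prodComm S S).hasSum_iff.2 hsum.hasSum
    exact hswap.prod_fiberwise fun y => (hinv y).mul_right (f y)
  rwa [h2.tsum_eq]

theorem tsum_mul_kernelOp_pow {f : S → ℝ} {B : ℝ} (hf : ∀ y, |f y| ≤ B) (n : ℕ) :
    ∑' x, π x * (kernelOp P hP.finite_support ^ n) f x = ∑' x, π x * f x := by
  induction n with
  | zero => rfl
  | succ n ih =>
    rw [pow_succ', ← ih]
    exact (hP.hasSum_mul_kernelOp hπ hπ1 hinv (hP.abs_kernelOp_pow_le hf n)).tsum_eq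

/-- The energies `∑_x π_x (Pⁿf)(x)²` decrease, and the energy lost in a step bounds
`π_x P(x, y) ((Pⁿf)(y) - (Pⁿ⁺¹f)(x))²`. -/
theorem tendsto_kernelOp_pow_sub {f : S → ℝ} {B : ℝ} (hf : ∀ y, |f y| ≤ B) {x y : S}
    (hxy : 0 < P x y) :
    Tendsto (fun n => (kernelOp P hP.finite_support ^ n) f y -
      (kernelOp P hP.finite_support ^ (n + 1)) f x) atTop (𝓝 0) := by
  set T := kernelOp P hP.finite_support
  let E : ℕ → ℝ := fun n => ∑' z, π z * ((T ^ n) f z) ^ 2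
  have hB (n : ℕ) (z : S) : |((T ^ n) f z) ^ 2| ≤ B ^ 2 := by
    rw [abs_pow]
    exact pow_le_pow_left₀ (abs_nonneg _) (hP.abs_kernelOp_pow_le hf n z) 2
  have hstep (n : ℕ) : HasSum (fun z => π z * (T (fun w => ((T ^ n) f w) ^ 2) z -
      ((T ^ (n + 1)) f z) ^ 2)) (E n - E (n + 1)) := by
    simp only [mul_sub]
    exact (hP.hasSum_mul_kernelOp hπ hπ1 hinv (hB n)).sub
      (summable_mul_of_bounded hπ hπ1 (hB (n + 1))).hasSum
  have hvar (n : ℕ) (z w : S) : P z w * ((T ^ n) f w - (T ^ (n + 1)) f z) ^ 2 ≤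
      T (fun w => ((T ^ n) f w) ^ 2) z - ((T ^ (n + 1)) f z) ^ 2 := by
    rw [pow_succ' T n]
    exact hP.mul_sq_le_variance ((T ^ n) f) z w
  have hvar0 (n : ℕ) (z : S) : 0 ≤ T (fun w => ((T ^ n) f w) ^ 2) z -
      ((T ^ (n + 1)) f z) ^ 2 :=
    (mul_nonneg (hP.nonneg z z) (sq_nonneg _)).trans (hvar n z z)
  have hanti : Antitone E := antitone_nat_of_succ_le fun n =>
    sub_nonneg.1 ((hstep n).nonneg fun z => mul_nonneg (hπ z).le (hvar0 n z))
  have hbdd : BddBelow (Set.range E) := by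
    refine ⟨0, ?_⟩
    rintro _ ⟨n, rfl⟩
    exact tsum_nonneg fun z => mul_nonneg (hπ z).le (sq_nonneg _)
  have hlim := tendsto_atTop_ciInf hanti hbdd
  have hdiff : Tendsto (fun n => (E n - E (n + 1)) / (π x * P x y)) atTop (𝓝 0) := by
    simpa using (hlim.sub (hlim.comp (tendsto_add_atTop_nat 1))).div_const (π x * P x y)
  have hpos : 0 < π x * P x y := mul_pos (hπ x) hxy
  have hsq : Tendsto (fun n => ((T ^ n) f y - (T ^ (n + 1)) f x) ^ 2) atTop (𝓝 0) := by
    refine squeeze_zero (fun n => sq_nonneg _) (fun n => ?_) hdiff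
    rw [le_div_iff₀' hpos, mul_assoc]
    exact (mul_le_mul_of_nonneg_left (hvar n x y) (hπ x).le).trans
      (le_hasSum (hstep n) x fun z _ => mul_nonneg (hπ z).le (hvar0 n z))
  have := hsq.sqrt
  simp only [Real.sqrt_sq_eq_abs, Real.sqrt_zero] at this
  exact (tendsto_zero_iff_abs_tendsto_zero _).2 this

/-- Convergence to the stationary mean for a chain that may stay where it is. -/
theorem tendsto_kernelOp_pow (hdiag : ∀ x, 0 < P x x)
    (hirr : ∀ x y, Relation.ReflTransGen (fun a b => 0 < P a b) x y)
    {f : S → ℝ} {B : ℝ} (hf : ∀ y, |f y| ≤ B) (x : S) :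
    Tendsto (fun n => (kernelOp P hP.finite_support ^ n) f x) atTop (𝓝 (∑' y, π y * f y)) := by
  set T := kernelOp P hP.finite_support
  have hstep {a b : S} (hab : 0 < P a b) :
      Tendsto (fun n => (T ^ n) f b - (T ^ n) f a) atTop (𝓝 0) := by
    have := (hP.tendsto_kernelOp_pow_sub hπ hπ1 hinv hf hab).sub
      (hP.tendsto_kernelOp_pow_sub hπ hπ1 hinv hf (hdiag a))
    simpa using this
  have hall (y : S) : Tendsto (fun n => (T ^ n) f y - (T ^ n) f x) atTop (𝓝 0) := by
    induction hirr x y with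
    | refl => simp
    | tail _ hab ih => simpa using (hstep hab).add ih
  have hmean : Tendsto (fun n => ∑' y, π y * ((T ^ n) f y - (T ^ n) f x)) atTop
      (𝓝 (∑' y, π y * 0)) := by
    refine tendsto_tsum_of_dominated_convergence (bound := fun y => π y * (B + B))
      (hπ1.summable.mul_right _) (fun y => (hall y).const_mul _) (Eventually.of_forall ?_)
    intro n y
    rw [norm_mul, Real.norm_of_nonneg (hπ y).le]
    exact mul_le_mul_of_nonneg_left ((abs_sub _ _).trans (add_le_add
      (hP.abs_kernelOp_pow_le hf n y) (hP.abs_kernelOp_pow_le hf n x))) (hπ y).le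
  have heq (n : ℕ) : ∑' y, π y * ((T ^ n) f y - (T ^ n) f x) =
      (∑' y, π y * f y) - (T ^ n) f x := by
    rw [← hP.tsum_mul_kernelOp_pow hπ hπ1 hinv hf n]
    simp only [mul_sub]
    rw [(summable_mul_of_bounded hπ hπ1 (hP.abs_kernelOp_pow_le hf n)).tsum_sub
      (hπ1.summable.mul_right _), tsum_mul_right, hπ1.tsum_eq, one_mul]
  simp only [heq, mul_zero, tsum_zero] at hmean
  simpa using hmean.const_sub (∑' y, π y * f y)

end IsStochastic

theorem hasSum_pow_div_factorial (s : ℝ) :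
    HasSum (fun n : ℕ => s ^ n / n.factorial) (Real.exp s) := by
  rw [Real.exp_eq_exp_ℝ]
  exact NormedSpace.expSeries_div_hasSum_exp s

/-- Averages of a convergent sequence with Poisson weights of growing mean have the same limit. -/
theorem tendsto_poisson_average {a : ℕ → ℝ} {l B : ℝ} (ha : Tendsto a atTop (𝓝 l))
    (hB : ∀ n, |a n| ≤ B) :
    Tendsto (fun s : ℝ => Real.exp (-s) * ∑' n : ℕ, s ^ n / n.factorial * a n) atTop (𝓝 l) := by
  have hsum (s : ℝ) (hs : 0 ≤ s) : Summable fun n : ℕ => s ^ n / n.factorial * a n := by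
    refine Summable.of_norm_bounded ((hasSum_pow_div_factorial s).summable.mul_right B) fun n => ?_
    rw [norm_mul, Real.norm_of_nonneg (by positivity)]
    exact mul_le_mul_of_nonneg_left (hB n) (by positivity)
  have hl : |l| ≤ B := le_of_tendsto ha.abs (Eventually.of_forall hB)
  rw [Metric.tendsto_atTop]
  intro ε hε
  obtain ⟨K, hK⟩ := (Metric.tendsto_atTop.1 ha) (ε / 2) (by positivity)
  -- The first `K` terms have total weight tending to `0`.
  have hhead : Tendsto (fun s : ℝ => ∑ n ∈ Finset.range K,
      2 * B / n.factorial * (s ^ n * Real.exp (-s))) atTop (𝓝 0) := by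
    have := tendsto_finsetSum (Finset.range K) fun n _ =>
      (Real.tendsto_pow_mul_exp_neg_atTop_nhds_zero n).const_mul (2 * B / n.factorial)
    simpa using this
  obtain ⟨s₀, hs₀⟩ := (Metric.tendsto_atTop.1 hhead) (ε / 2) (by positivity)
  refine ⟨max s₀ 0, fun s hs => ?_⟩
  have hs1 := hs₀ s ((le_max_left _ _).trans hs)
  have hs0 : 0 ≤ s := (le_max_right _ _).trans hs
  have hw (n : ℕ) : 0 ≤ s ^ n / n.factorial * Real.exp (-s) := by positivity
  have hdiff : HasSum (fun n : ℕ => s ^ n / n.factorial * Real.exp (-s) * (a n - l))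
      (Real.exp (-s) * ∑' n : ℕ, s ^ n / n.factorial * a n - l) := by
    have h1 := (hsum s hs0).hasSum.mul_left (Real.exp (-s))
    have h2 := (hasSum_pow_div_factorial s).mul_left (Real.exp (-s) * l)
    have e1 : (fun n : ℕ => s ^ n / n.factorial * Real.exp (-s) * (a n - l)) = fun n =>
        Real.exp (-s) * (s ^ n / n.factorial * a n) -
          Real.exp (-s) * l * (s ^ n / n.factorial) := by
      funext n; ring
    have e2 : Real.exp (-s) * l * Real.exp s = l := by
      rw [mul_right_comm, ← Real.exp_add]; simp
    rw [e2] at h2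
    rw [e1]
    exact h1.sub h2
  have hmaj : HasSum (fun n : ℕ => s ^ n / n.factorial * Real.exp (-s) * (ε / 2) +
      if n ∈ Finset.range K then 2 * B / n.factorial * (s ^ n * Real.exp (-s)) else 0)
      (ε / 2 + ∑ n ∈ Finset.range K, 2 * B / n.factorial * (s ^ n * Real.exp (-s))) := by
    refine HasSum.add ?_ ?_
    · have h1 := ((hasSum_pow_div_factorial s).mul_right (Real.exp (-s))).mul_right (ε / 2)
      rwa [← Real.exp_add, add_neg_cancel, Real.exp_zero, one_mul] at h1
    · have := hasSum_sum_of_ne_finset_zero (L := .unconditional ℕ) (s := Finset.range K)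
        (f := fun n : ℕ => if n ∈ Finset.range K then
          2 * B / n.factorial * (s ^ n * Real.exp (-s)) else 0) fun n hn => if_neg hn
      rwa [Finset.sum_ite_of_true (p := fun n => n ∈ Finset.range K) fun n hn => hn] at this
  have hterm (n : ℕ) : ‖s ^ n / n.factorial * Real.exp (-s) * (a n - l)‖ ≤
      s ^ n / n.factorial * Real.exp (-s) * (ε / 2) +
      if n ∈ Finset.range K then 2 * B / n.factorial * (s ^ n * Real.exp (-s)) else 0 := by
    rw [norm_mul, Real.norm_of_nonneg (hw n)]
    split_ifs with hn
    · have h1 : ‖a n - l‖ ≤ 2 * B := (abs_sub _ _).trans (by linarith [hB n])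
      calc s ^ n / n.factorial * Real.exp (-s) * ‖a n - l‖
          ≤ s ^ n / n.factorial * Real.exp (-s) * (2 * B) := mul_le_mul_of_nonneg_left h1 (hw n)
        _ = 2 * B / n.factorial * (s ^ n * Real.exp (-s)) := by ring
        _ ≤ _ := le_add_of_nonneg_left (mul_nonneg (hw n) (by positivity))
    · rw [add_zero]
      refine mul_le_mul_of_nonneg_left ?_ (hw n)
      exact (hK n (by simpa using hn)).le
  rw [Real.dist_eq]
  refine (hdiff.norm_le_of_bounded hmaj hterm).trans_lt ?_
  have := (abs_lt.1 (by simpa [Real.dist_eq] using hs1)).2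
  linarith

end CTMC

/-! ### Uniformization -/

namespace CTMC

variable {S : Type*} {q : S → S → ℝ≥0} {Λ : ℝ≥0}

open Classical in
/-- The uniformized chain: `P = 1 + Q / Λ`. -/
noncomputable def uniformized (q : S → S → ℝ≥0) (Λ : ℝ≥0) (x y : S) : ℝ :=
  (if y = x then 1 else 0) + generator q x y / Λ

namespace IsUniformizable

open Classical in
theorem generator_eq (h : IsUniformizable q Λ) (x y : S) :
    generator q x y = q x y - if y = x then (sojournRate q x : ℝ) else 0 := by
  unfold generator
  split_ifs with hy
  · rw [hy, h.diag]; simp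
  · simp

theorem finite_support_generator (h : IsUniformizable q Λ) (x : S) :
    (Function.support (generator q x)).Finite := by
  refine ((h.finite_support x).union (Set.finite_singleton x)).subset fun y hy => ?_
  by_contra hn
  simp only [Set.mem_union, Function.mem_support, Set.mem_singleton_iff, not_or, not_not] at hn
  exact hy (by simp [generator, hn.1, hn.2])

theorem finite_support_uniformized (h : IsUniformizable q Λ) (x : S) :
    (Function.support (uniformized q Λ x)).Finite := by
  refine ((h.finite_support_generator x).union (Set.finite_singleton x)).subset fun y hy => ?_
  by_contra hn
  simp only [Set.mem_union, Function.mem_support, Set.mem_singleton_iff, not_or, not_not] at hn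
  exact hy (by simp [uniformized, hn.1, hn.2])

theorem pos (h : IsUniformizable q Λ) (x : S) : (0 : ℝ) < Λ := by
  exact_mod_cast zero_le.trans_lt (h.sojournRate_lt x)

theorem uniformized_self (h : IsUniformizable q Λ) (x : S) : 0 < uniformized q Λ x x := by
  have h1 : (sojournRate q x : ℝ) < Λ := by exact_mod_cast h.sojournRate_lt x
  have h2 := (div_lt_one (h.pos x)).2 h1
  simp only [uniformized, generator, if_true]
  rw [neg_div]
  linarith

theorem uniformized_of_ne {x y : S} (hxy : y ≠ x) : uniformized q Λ x y = q x y / Λ := by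
  simp [uniformized, generator, hxy]

theorem isStochastic (h : IsUniformizable q Λ) : IsStochastic (uniformized q Λ) where
  nonneg x y := by
    by_cases hxy : y = x
    · rw [hxy]; exact (h.uniformized_self x).le
    · rw [uniformized_of_ne hxy]; positivity
  hasSum_one x := by
    classical
    have h1 : HasSum (generator q x) 0 := by
      have := (h.hasSum_rate x).sub (hasSum_ite_eq x (sojournRate q x : ℝ))
      rw [sub_self] at this
      exact this.congr_fun fun y => h.generator_eq x y
    have h2 := (hasSum_ite_eq x (1 : ℝ)).add (h1.div_const (Λ : ℝ))
    rw [zero_div, add_zero] at h2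
    exact h2.congr_fun fun y => rfl
  finite_support := h.finite_support_uniformized

theorem uniformized_irreducible (h : IsUniformizable q Λ) (hirr : IsIrreducible q) (x y : S) :
    Relation.ReflTransGen (fun a b => 0 < uniformized q Λ a b) x y := by
  refine Relation.ReflTransGen.mono (fun a b hab => ?_) _ _ (hirr x y)
  have hne : b ≠ a := by
    rintro rfl
    exact hab.ne' (h.diag b)
  rw [uniformized_of_ne hne]
  exact div_pos (by exact_mod_cast hab) (h.pos a)

theorem uniformized_stationary (h : IsUniformizable q Λ) {π : S → ℝ} (hπ : IsStationary q π)
    (y : S) : HasSum (fun x => π x * uniformized q Λ x y) (π y) := by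
  classical
  have h1 : HasSum (fun x => π x * generator q x y) 0 := by
    have := (hπ.balance y).sub (hasSum_ite_eq y (π y * sojournRate q y))
    rw [sub_self] at this
    refine this.congr_fun fun x => ?_
    rw [h.generator_eq, mul_sub]
    by_cases hxy : x = y
    · subst hxy; simp
    · simp [hxy, Ne.symm hxy]
  have h2 := (hasSum_ite_eq y (π y)).add (h1.div_const (Λ : ℝ))
  rw [zero_div, add_zero] at h2
  refine h2.congr_fun fun x => ?_
  rw [uniformized, mul_add, mul_div_assoc]
  by_cases hxy : x = y
  · subst hxy; simp
  · simp [hxy, Ne.symm hxy]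

/-- `Q = Λ P - Λ`. -/
theorem kernelOp_generator (h : IsUniformizable q Λ) :
    kernelOp (generator q) h.finite_support_generator =
      (Λ : ℝ) • kernelOp (uniformized q Λ) h.finite_support_uniformized +
        (-Λ : ℝ) • (1 : Module.End ℝ (S → ℝ)) := by
  classical
  ext f x
  have hΛ := (h.pos x).ne'
  have h1 := (hasSum_kernelOp _ h.finite_support_uniformized f x).mul_left (Λ : ℝ)
  have h2 := hasSum_ite_eq x (-Λ * f x : ℝ)
  refine ((hasSum_kernelOp _ h.finite_support_generator f x).unique ?_)
  refine (h1.add h2).congr_fun fun y => ?_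
  by_cases hxy : y = x
  · subst hxy
    simp only [uniformized, if_true]
    field_simp
    ring
  · simp only [uniformized, hxy, if_false]
    field_simp
    ring

theorem generatorPow_eq (h : IsUniformizable q Λ) (n : ℕ) (x y : S) :
    generatorPow q n x y = (kernelOp (generator q) h.finite_support_generator ^ n)
      (fun z => generatorPow q 0 z y) x := by
  induction n generalizing x with
  | zero => rfl
  | succ n ih =>
    rw [pow_succ']
    have : (fun z => generatorPow q n z y) = (kernelOp (generator q)
      h.finite_support_generator ^ n) (fun z => generatorPow q 0 z y) := funext ih
    change ∑' z, generator q x z * generatorPow q n z y = _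
    simp only [ih]
    rfl

/-- Uniformization: the transition function is the Poisson average of the powers of `P`. -/
theorem transition_eq (h : IsUniformizable q Λ) (t : ℝ) (x y : S) :
    transition q t x y = Real.exp (-(t * Λ)) * ∑' n : ℕ, (t * Λ) ^ n / n.factorial *
      (kernelOp (uniformized q Λ) h.finite_support_uniformized ^ n)
        (fun z => generatorPow q 0 z y) x := by
  set T := kernelOp (uniformized q Λ) h.finite_support_uniformized with hT
  set δ : S → ℝ := fun z => generatorPow q 0 z y
  have hδ (z : S) : |δ z| ≤ 1 := by
    simp only [δ, generatorPow]
    split_ifs <;> simp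
  have hnorm (s : ℝ) : Summable fun n : ℕ => ‖s ^ n / n.factorial‖ := by
    simpa using (hasSum_pow_div_factorial |s|).summable
  have hpow (n : ℕ) : generatorPow q n x y = ∑ p ∈ Finset.HasAntidiagonal.antidiagonal n,
      (n.choose p.1 : ℝ) * ((Λ : ℝ) ^ p.1 * (-Λ) ^ p.2 * (T ^ p.1) δ x) := by
    rw [h.generatorPow_eq, h.kernelOp_generator, Commute.add_pow' (by
      exact (Commute.one_right _).smul_right _)]
    simp only [LinearMap.coe_sum, Finset.sum_apply, ← hT, smul_pow, one_pow]
    refine Finset.sum_congr rfl fun p _ => ?_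
    simp [mul_assoc, δ]
    ring
  have hterm (n : ℕ) : t ^ n / n.factorial * generatorPow q n x y =
      ∑ p ∈ Finset.HasAntidiagonal.antidiagonal n, ((-(t * Λ)) ^ p.2 / p.2.factorial) *
        ((t * Λ) ^ p.1 / p.1.factorial * (T ^ p.1) δ x) := by
    rw [hpow, Finset.mul_sum]
    refine Finset.sum_congr rfl fun p hp => ?_
    rw [Finset.HasAntidiagonal.mem_antidiagonal] at hp
    subst hp
    have := Nat.add_choose_mul_factorial_mul_factorial p.1 p.2
    rw [← Nat.choose_symm_add] at this
    have h1 : ((p.1 + p.2).choose p.1 : ℝ) * p.1.factorial * p.2.factorial =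
      (p.1 + p.2).factorial := by exact_mod_cast this
    have h2 : ((p.1 + p.2).factorial : ℝ) ≠ 0 := by positivity
    rw [← h1] at h2 ⊢
    have h3 : (p.1.factorial : ℝ) ≠ 0 := by positivity
    have h4 : (p.2.factorial : ℝ) ≠ 0 := by positivity
    have h5 : ((p.1 + p.2).choose p.1 : ℝ) ≠ 0 := by
      intro h0; simp [h0] at h2
    rw [neg_pow (t * Λ : ℝ), neg_pow (Λ : ℝ), mul_pow, mul_pow, pow_add]
    field_simp
  have hsum : Summable fun n : ℕ => ‖(t * Λ) ^ n / n.factorial * (T ^ n) δ x‖ := by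
    refine Summable.of_nonneg_of_le (fun _ => norm_nonneg _) (fun n => ?_) (hnorm (t * Λ))
    rw [norm_mul]
    exact mul_le_of_le_one_right (norm_nonneg _) (h.isStochastic.abs_kernelOp_pow_le hδ n x)
  rw [← (hasSum_pow_div_factorial _).tsum_eq, mul_comm,
    tsum_mul_tsum_eq_tsum_sum_antidiagonal_of_summable_norm hsum (hnorm _)]
  refine tsum_congr fun n => ?_
  rw [hterm]
  exact Finset.sum_congr rfl fun p _ => mul_comm _ _

theorem tendsto_transition (h : IsUniformizable q Λ) (hirr : IsIrreducible q) {π : S → ℝ}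
    (hπ : IsStationary q π) (x y : S) :
    Tendsto (fun t : ℝ => transition q t x y) atTop (𝓝 (π y)) := by
  classical
  have hδ (z : S) : |generatorPow q 0 z y| ≤ 1 := by
    simp only [generatorPow]
    split_ifs <;> simp
  have h1 := h.isStochastic.tendsto_kernelOp_pow hπ.pos hπ.hasSum_one
    (h.uniformized_stationary hπ) h.uniformized_self (h.uniformized_irreducible hirr) hδ x
  have h2 : ∑' z, π z * generatorPow q 0 z y = π y := by
    simp [generatorPow]
  rw [h2] at h1
  have h3 := tendsto_poisson_average h1 fun n => h.isStochastic.abs_kernelOp_pow_le hδ n x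
  simp only [h.transition_eq]
  exact h3.comp (tendsto_id.atTop_mul_const (h.pos x))

end IsUniformizable

theorem IsStationary.isLimitingDistribution (h : IsUniformizable q Λ) (hirr : IsIrreducible q)
    {π : S → ℝ} (hπ : IsStationary q π) : IsLimitingDistribution q π where
  nonneg x := (hπ.pos x).le
  hasSum_one := hπ.hasSum_one
  tendsto := h.tendsto_transition hirr hπ

end CTMC

/-! ### Transition rates and sojourn rates -/

namespace QBDRates

variable {N : Type*} {M : ℕ}

/-- The levels `j ≥ j₀`, enumerated as `j₀ + n`. -/
def levelEquiv (j₀ : ℕ) : ℕ ≃ {j : ℕ // j₀ ≤ j} where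
  toFun n := ⟨j₀ + n, Nat.le_add_right _ _⟩
  invFun j := j.1 - j₀
  left_inv n := by simp
  right_inv j := by ext; simp [Nat.add_sub_cancel' j.2]

theorem coe_levelEquiv (j₀ n : ℕ) : (levelEquiv j₀ n : ℕ) = j₀ + n := rfl

theorem hasSum_two {g : ℕ → ℝ} (hg : ∀ l, 2 ≤ l → g l = 0) : HasSum g (g 0 + g 1) := by
  have := hasSum_sum_of_ne_finset_zero (f := g) (s := Finset.range 2) (L := .unconditional ℕ)
    fun l hl => hg l (by rw [Finset.mem_range] at hl; omega)
  simpa [Finset.sum_range_succ] using this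

theorem hasSum_three {g : ℕ → ℝ} (n : ℕ) (hg : ∀ l, l < n ∨ n + 2 < l → g l = 0) :
    HasSum g (g n + g (n + 1) + g (n + 2)) := by
  have := hasSum_sum_of_ne_finset_zero (f := g) (s := {n, n + 1, n + 2}) (L := .unconditional ℕ)
    fun l hl => hg l (by simp at hl; omega)
  rwa [Finset.sum_insert (by simp), Finset.sum_insert (by simp), Finset.sum_singleton,
    ← add_assoc] at this

theorem sum_Icc_neg_one_one (f : ℤ → ℝ) :
    ∑ Δ ∈ Finset.Icc (-1 : ℤ) 1, f Δ = f (-1) + f 0 + f 1 := by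
  rw [show Finset.Icc (-1 : ℤ) 1 = {-1, 0, 1} by rfl]
  simp [add_assoc]

theorem sum_Icc_zero_one (f : ℤ → ℝ) : ∑ Δ ∈ Finset.Icc (0 : ℤ) 1, f Δ = f 0 + f 1 := by
  rw [show Finset.Icc (0 : ℤ) 1 = {0, 1} by rfl]
  simp

theorem sum_ite_eq_ite_lt (m : Fin (M + 1)) (a : ℝ) (b : Fin (M + 1) → ℝ) :
    ∑ i, (if i = m then a else if m < i then b i else 0) = a + ∑ i ∈ Finset.Ioi m, b i := by
  have h (i : Fin (M + 1)) : (if i = m then a else if m < i then b i else 0) =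
      (if i = m then a else 0) + if m < i then b i else 0 := by
    by_cases hi : i = m
    · simp [hi]
    · simp [hi]
  rw [Finset.sum_congr rfl fun i _ => h i, Finset.sum_add_distrib,
    ← Finset.sum_filter _ (fun i => b i),
    Finset.filter_lt_eq_Ioi, Finset.sum_ite_eq' _ m fun _ => a, if_pos (Finset.mem_univ m)]

theorem sum_ite_eq_ite_gt (m : Fin (M + 1)) (a : ℝ) (b : Fin (M + 1) → ℝ) :
    ∑ i, (if i = m then a else if i < m then b i else 0) = a + ∑ i ∈ Finset.Iio m, b i := by
  have h (i : Fin (M + 1)) : (if i = m then a else if i < m then b i else 0) =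
      (if i = m then a else 0) + if i < m then b i else 0 := by
    by_cases hi : i = m
    · simp [hi]
    · simp [hi]
  rw [Finset.sum_congr rfl fun i _ => h i, Finset.sum_add_distrib,
    ← Finset.sum_filter _ (fun i => b i),
    Finset.filter_gt_eq_Iio, Finset.sum_ite_eq' _ m fun _ => a, if_pos (Finset.mem_univ m)]

variable (C : QBDRates N M) (j₀ : ℕ)

theorem rate_inl_inr (x : N) (m : Fin (M + 1)) (n : ℕ) :
    C.rate j₀ (.inl x) (.inr (m, levelEquiv j₀ n)) = if n = 0 then C.rateNR x m else 0 := by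
  simp [rate, coe_levelEquiv]

theorem rate_inr_inl (x : N) (m : Fin (M + 1)) (n : ℕ) :
    C.rate j₀ (.inr (m, levelEquiv j₀ n)) (.inl x) = if n = 0 then C.rateRN m x else 0 := by
  simp [rate, coe_levelEquiv]

theorem rate_inr_inr_self (m : Fin (M + 1)) (n l : ℕ) :
    C.rate j₀ (.inr (m, levelEquiv j₀ n)) (.inr (m, levelEquiv j₀ l)) =
      if l = n + 1 then C.lam m else if l + 1 = n then C.mu m else 0 := by
  simp [rate, coe_levelEquiv, add_assoc]

theorem rate_inr_inr_of_lt {m i : Fin (M + 1)} (hmi : m < i) (n l : ℕ) :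
    C.rate j₀ (.inr (m, levelEquiv j₀ n)) (.inr (i, levelEquiv j₀ l)) =
      if (l : ℤ) - n ∈ Finset.Icc (-1 : ℤ) 1 then C.alpha m i (l - n) else 0 := by
  simp [rate, coe_levelEquiv, hmi, hmi.ne]

theorem rate_inr_inr_of_gt {m i : Fin (M + 1)} (hmi : i < m) (n l : ℕ) :
    C.rate j₀ (.inr (m, levelEquiv j₀ n)) (.inr (i, levelEquiv j₀ l)) = 0 := by
  simp [rate, hmi.not_gt, hmi.ne']

theorem rate_self (x : QBDState N M j₀) : C.rate j₀ x x = 0 := by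
  rcases x with x | ⟨m, j⟩
  · exact C.rateNN_self x
  · simp [rate]

theorem finite_support_rate [Finite N] (x : QBDState N M j₀) :
    (Function.support (C.rate j₀ x)).Finite := by
  have hfin (B : ℕ) : (Set.range Sum.inl ∪ Sum.inr '' {p | p.2.1 ≤ B} :
      Set (QBDState N M j₀)).Finite := by
    refine (Set.finite_range _).union (Set.Finite.image _ ?_)
    have h1 : {l : {j : ℕ // j₀ ≤ j} | l.1 ≤ B}.Finite :=
      (Set.finite_Iic B).preimage Subtype.val_injective.injOn
    exact (Set.finite_univ.prod h1).subset fun p hp => ⟨trivial, hp⟩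
  rcases x with x | ⟨m, j⟩
  · refine (hfin j₀).subset ?_
    rintro (y | ⟨i, l⟩) hy
    · exact Or.inl ⟨y, rfl⟩
    · refine Or.inr ⟨_, ?_, rfl⟩
      by_contra hl
      have : l.1 ≠ j₀ := fun h => hl h.le
      exact hy (by simp [rate, this])
  · refine (hfin (j.1 + 1)).subset ?_
    rintro (y | ⟨i, l⟩) hy
    · exact Or.inl ⟨y, rfl⟩
    · refine Or.inr ⟨_, ?_, rfl⟩
      by_contra hl
      simp only [Set.mem_ofPred_eq, not_le] at hl
      refine hy ?_
      have h1 : l.1 ≠ j.1 + 1 := hl.ne'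
      have h2 : l.1 + 1 ≠ j.1 := by omega
      have h3 : ¬ (l.1 : ℤ) - j.1 ≤ 1 := by omega
      simp [rate, h1, h2, h3, -tsub_le_iff_right]

variable {C j₀}

/-- A sum over all states, computed phase by phase. -/
theorem hasSum_eq_of_fibers [Fintype N] {F : QBDState N M j₀ → ℝ} {a : ℝ} (hF : HasSum F a)
    {b : Fin (M + 1) → ℝ}
    (hb : ∀ m, HasSum (fun n => F (.inr (m, levelEquiv j₀ n))) (b m)) :
    a = ∑ x, F (.inl x) + ∑ m, b m := by
  have hr : Summable fun p => F (.inr p) := hF.summable.comp_injective Sum.inr_injective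
  have h1 : HasSum b (∑' p, F (.inr p)) :=
    hr.hasSum.prod_fiberwise fun m => (levelEquiv j₀).hasSum_iff.1 (hb m)
  rw [(hasSum_fintype b).unique h1]
  exact hF.unique ((hasSum_fintype fun x => F (.inl x)).sum hr.hasSum)

section Outflow

variable [Fintype N]

theorem hasSum_sojournRate (x : QBDState N M j₀) :
    HasSum (fun y => (C.rate j₀ x y : ℝ)) (CTMC.sojournRate (C.rate j₀) x) := by
  rw [CTMC.sojournRate_eq_tsum (C.rate_self j₀)]
  exact_mod_cast (summable_of_hasFiniteSupport (C.finite_support_rate j₀ x)).hasSum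

theorem sojournRate_inl (x : N) : (CTMC.sojournRate (C.rate j₀) (.inl x) : ℝ) =
    ∑ m, (C.rateNR x m : ℝ) + ∑ y, (C.rateNN x y : ℝ) := by
  rw [hasSum_eq_of_fibers (hasSum_sojournRate _) (b := fun m => (C.rateNR x m : ℝ)), add_comm]
  · rfl
  · intro m
    simp only [rate_inl_inr]
    simpa using hasSum_two (g := fun n => ((if n = 0 then C.rateNR x m else 0 : ℝ≥0) : ℝ))
      fun l hl => by simp [show l ≠ 0 by omega]

theorem sojournRate_zero (m : Fin (M + 1)) :
    (CTMC.sojournRate (C.rate j₀) (.inr (m, levelEquiv j₀ 0)) : ℝ) =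
      C.lam m + ∑ i ∈ Finset.Ioi m, ∑ Δ ∈ Finset.Icc (0 : ℤ) 1, (C.alpha m i Δ : ℝ) +
        ∑ x, (C.rateRN m x : ℝ) := by
  rw [hasSum_eq_of_fibers (hasSum_sojournRate _) (b := fun i => if i = m then C.lam m else
    if m < i then ∑ Δ ∈ Finset.Icc (0 : ℤ) 1, (C.alpha m i Δ : ℝ) else 0), sum_ite_eq_ite_lt,
    add_comm]
  · simp only [rate_inr_inl, if_true]
  · intro i
    rcases lt_trichotomy i m with h | rfl | h
    · simp [rate_inr_inr_of_gt C j₀ h, h.ne, h.not_gt]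
    · simp only [rate_inr_inr_self, if_true]
      convert hasSum_two _ using 1
      · simp
      · intro l hl
        simp [show l ≠ 1 by omega]
    · simp only [rate_inr_inr_of_lt C j₀ h, h.ne', h, if_true, if_false, sum_Icc_zero_one]
      convert hasSum_two _ using 1
      · simp
      · intro l hl
        rw [if_neg (by simp only [Finset.mem_Icc]; omega)]
        rfl

theorem sojournRate_succ (m : Fin (M + 1)) (n : ℕ) :
    (CTMC.sojournRate (C.rate j₀) (.inr (m, levelEquiv j₀ (n + 1))) : ℝ) =
      C.lam m + C.mu m + C.alphaTot m := by
  rw [hasSum_eq_of_fibers (hasSum_sojournRate _) (b := fun i => if i = m then C.lam m + C.mu m else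
    if m < i then ∑ Δ ∈ Finset.Icc (-1 : ℤ) 1, (C.alpha m i Δ : ℝ) else 0), sum_ite_eq_ite_lt]
  · simp [rate_inr_inl, alphaTot]
  · intro i
    rcases lt_trichotomy i m with h | rfl | h
    · simp [rate_inr_inr_of_gt C j₀ h, h.ne, h.not_gt]
    · simp only [rate_inr_inr_self, if_true]
      convert hasSum_three n _ using 1
      · simp [show ¬ n = n + 1 + 1 by omega]
        exact add_comm _ _
      · intro l hl
        rw [if_neg (by omega), if_neg (by omega)]
        rfl
    · simp only [rate_inr_inr_of_lt C j₀ h, h.ne', h, if_true, if_false, sum_Icc_neg_one_one]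
      convert hasSum_three n _ using 1
      · simp [add_assoc]
      · intro l hl
        rw [if_neg (by simp only [Finset.mem_Icc]; omega)]
        rfl

end Outflow
end QBDRates

/-! ### Balance equations -/

namespace QBDRates

variable {N : Type*} {M : ℕ} {C : QBDRates N M} {j₀ : ℕ}

instance : Nontrivial (QBDState N M j₀) :=
  ⟨⟨.inr (0, levelEquiv j₀ 0), .inr (0, levelEquiv j₀ 1), by simp⟩⟩

/-- The sojourn rates take finitely many values, so that the chain can be uniformized. -/
theorem exists_isUniformizable [Finite N] (C : QBDRates N M) (j₀ : ℕ) :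
    ∃ Λ, CTMC.IsUniformizable (C.rate j₀) Λ := by
  have := Fintype.ofFinite N
  let ν := CTMC.sojournRate (C.rate j₀)
  have hfin : (Set.range ν).Finite := by
    have hsub : Set.range ν ⊆ Set.range (fun x : N => ν (.inl x)) ∪
        (Set.range (fun m => ν (.inr (m, levelEquiv j₀ 0))) ∪
          Set.range (fun m => ν (.inr (m, levelEquiv j₀ 1)))) := by
      rintro _ ⟨x | ⟨m, j⟩, rfl⟩
      · exact Or.inl ⟨x, rfl⟩
      · obtain ⟨n, rfl⟩ := (levelEquiv j₀).surjective j
        rcases n with _ | n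
        · exact Or.inr (Or.inl ⟨m, rfl⟩)
        · refine Or.inr (Or.inr ⟨m, NNReal.coe_injective ?_⟩)
          exact (sojournRate_succ m 0).trans (sojournRate_succ m n).symm
    exact ((Set.finite_range _).union
      ((Set.finite_range _).union (Set.finite_range _))).subset hsub
  obtain ⟨B, hB⟩ := hfin.bddAbove
  exact ⟨B + 1, C.rate_self j₀, C.finite_support_rate j₀,
    fun x => (hB ⟨x, rfl⟩).trans_lt (lt_add_of_pos_right _ one_pos)⟩

section Balance

variable [Fintype N] {π : QBDState N M j₀ → ℝ}
  (hbal : ∀ y, HasSum (fun x => π x * C.rate j₀ x y) (π y * CTMC.sojournRate (C.rate j₀) y))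
include hbal

/-- Flow balance of a nonrepeating state. -/
theorem balance_inl (x : N) :
    π (.inl x) * (∑ m, (C.rateNR x m : ℝ) + ∑ y, (C.rateNN x y : ℝ)) =
      ∑ m, C.rateRN m x * π (.inr (m, levelEquiv j₀ 0)) + ∑ y, C.rateNN y x * π (.inl y) := by
  rw [← sojournRate_inl, hasSum_eq_of_fibers (hbal _)
    (b := fun m => C.rateRN m x * π (.inr (m, levelEquiv j₀ 0))), add_comm]
  · congr 1
    exact Finset.sum_congr rfl fun y _ => mul_comm _ _
  · intro m
    simp only [rate_inr_inl]
    convert hasSum_two _ using 1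
    · simp [mul_comm]
    · intro l hl
      simp [show l ≠ 0 by omega]

/-- Flow balance of a state at the lowest level. -/
theorem balance_zero (m : Fin (M + 1)) :
    π (.inr (m, levelEquiv j₀ 0)) * (C.lam m +
      ∑ i ∈ Finset.Ioi m, ∑ Δ ∈ Finset.Icc (0 : ℤ) 1, (C.alpha m i Δ : ℝ) +
        ∑ x, (C.rateRN m x : ℝ)) =
      C.mu m * π (.inr (m, levelEquiv j₀ 1)) + ∑ x, C.rateNR x m * π (.inl x) +
        ∑ i ∈ Finset.Iio m, (C.alpha i m (-1) * π (.inr (i, levelEquiv j₀ 1)) +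
          C.alpha i m 0 * π (.inr (i, levelEquiv j₀ 0))) := by
  rw [← sojournRate_zero, hasSum_eq_of_fibers (hbal _) (b := fun i => if i = m then
    C.mu m * π (.inr (m, levelEquiv j₀ 1)) else if i < m then
      C.alpha i m (-1) * π (.inr (i, levelEquiv j₀ 1)) +
        C.alpha i m 0 * π (.inr (i, levelEquiv j₀ 0)) else 0), sum_ite_eq_ite_gt]
  · simp only [rate_inl_inr, if_true, mul_comm (π (.inl _))]
    ring
  · intro i
    rcases lt_trichotomy i m with h | rfl | h
    · simp only [rate_inr_inr_of_lt C j₀ h, h.ne, h, if_true, if_false]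
      convert hasSum_two _ using 1
      · simp; ring
      · intro l hl
        rw [if_neg (by simp only [Finset.mem_Icc]; omega)]
        simp
    · simp only [rate_inr_inr_self, if_true]
      convert hasSum_two _ using 1
      · simp; ring
      · intro l hl
        simp [show 1 ≠ l by omega]
    · simp [rate_inr_inr_of_gt C j₀ h, h.ne', h.not_gt]

/-- Flow balance of a state above the lowest level. -/
theorem balance_succ (m : Fin (M + 1)) (n : ℕ) :
    π (.inr (m, levelEquiv j₀ (n + 1))) * (C.lam m + C.mu m + C.alphaTot m) =
      C.lam m * π (.inr (m, levelEquiv j₀ n)) + C.mu m * π (.inr (m, levelEquiv j₀ (n + 2))) +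
        ∑ i ∈ Finset.Iio m, (C.alpha i m (-1) * π (.inr (i, levelEquiv j₀ (n + 2))) +
          C.alpha i m 0 * π (.inr (i, levelEquiv j₀ (n + 1))) +
            C.alpha i m 1 * π (.inr (i, levelEquiv j₀ n))) := by
  rw [← sojournRate_succ m n, hasSum_eq_of_fibers (hbal _) (b := fun i => if i = m then
    C.lam m * π (.inr (m, levelEquiv j₀ n)) + C.mu m * π (.inr (m, levelEquiv j₀ (n + 2)))
      else if i < m then C.alpha i m (-1) * π (.inr (i, levelEquiv j₀ (n + 2))) +
          C.alpha i m 0 * π (.inr (i, levelEquiv j₀ (n + 1))) +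
            C.alpha i m 1 * π (.inr (i, levelEquiv j₀ n)) else 0), sum_ite_eq_ite_gt]
  · simp [rate_inl_inr]
  · intro i
    rcases lt_trichotomy i m with h | rfl | h
    · simp only [rate_inr_inr_of_lt C j₀ h, h.ne, h, if_true, if_false]
      convert hasSum_three n _ using 1
      · simp; ring
      · intro l hl
        rw [if_neg (by simp only [Finset.mem_Icc]; omega)]
        simp
    · simp only [rate_inr_inr_self, if_true]
      convert hasSum_three n _ using 1
      · simp; ring
      · intro l hl
        rw [if_neg (by omega), if_neg (by omega)]
        simp
    · simp [rate_inr_inr_of_gt C j₀ h, h.ne', h.not_gt]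

end Balance

end QBDRates

/-! ### Linear recurrences of second order -/

/-- A null sequence that satisfies a second-order linear recurrence whose characteristic polynomial
`μ z² - σ z + ℓ` has the root `r`, and `(σ - μ r) / μ ≥ 1` as the other one, is geometric with
ratio `r`: the sequence `e_{n+1} - r e_n` tends to `0` but does not decrease in absolute value. The
degenerate case `μ = 0` is included. -/
theorem eq_pow_mul_of_recurrence {e : ℕ → ℝ} {ℓ μ σ r : ℝ} (hroot : μ * r ^ 2 - σ * r + ℓ = 0)
    (hμ : 0 ≤ μ) (hle : μ ≤ σ - μ * r) (hpos : 0 < σ - μ * r)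
    (hrec : ∀ n, μ * e (n + 2) - σ * e (n + 1) + ℓ * e n = 0) (hlim : Tendsto e atTop (𝓝 0))
    (n : ℕ) : e n = r ^ n * e 0 := by
  let d : ℕ → ℝ := fun n => e (n + 1) - r * e n
  have hd (n : ℕ) : μ * d (n + 1) = (σ - μ * r) * d n := by
    simp only [d]
    linear_combination hrec n - e n * hroot
  have hmono : Monotone fun n => |d n| := monotone_nat_of_le_succ fun n => by
    have h1 : μ * |d (n + 1)| = (σ - μ * r) * |d n| := by
      rw [← abs_of_nonneg hμ, ← abs_mul, abs_of_nonneg hμ, hd, abs_mul, abs_of_pos hpos]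
    refine le_of_mul_le_mul_left (h1 ▸ ?_) hpos
    exact mul_le_mul_of_nonneg_right hle (abs_nonneg _)
  have hdlim : Tendsto (fun n => |d n|) atTop (𝓝 0) := by
    have := ((hlim.comp (tendsto_add_atTop_nat 1)).sub (hlim.const_mul r)).abs
    simpa using this
  have hd0 (n : ℕ) : d n = 0 := abs_nonpos_iff.1 (hmono.ge_of_tendsto hdlim n)
  induction n with
  | zero => simp
  | succ n ih =>
    have h1 : e (n + 1) = r * e n := sub_eq_zero.1 (hd0 n)
    rw [h1, ih, pow_succ]
    ring

/-- A positive null sequence satisfying the balance equations of a phase without exits has upward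
rate `ℓ` below its downward rate `μ`: the net downward flow `μ x_{n+1} - ℓ x_n` decreases to `0`. -/
theorem lt_of_recurrence {x g : ℕ → ℝ} {ℓ μ : ℝ} (hpos : 0 < ℓ + μ)
    (hx : ∀ n, 0 < x n) (hg : ∀ n, 0 ≤ g n)
    (hrec : ∀ n, x (n + 1) * (ℓ + μ) = ℓ * x n + μ * x (n + 2) + g n)
    (hlim : Tendsto x atTop (𝓝 0)) : ℓ < μ := by
  by_contra! hle
  have hanti : Antitone fun n => μ * x (n + 1) - ℓ * x n := antitone_nat_of_succ_le fun n => by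
    linarith [hrec n, hg n]
  have hulim : Tendsto (fun n => μ * x (n + 1) - ℓ * x n) atTop (𝓝 0) := by
    simpa using ((hlim.comp (tendsto_add_atTop_nat 1)).const_mul μ).sub (hlim.const_mul ℓ)
  have hu (n : ℕ) : ℓ * x n ≤ μ * x (n + 1) := sub_nonneg.1 (hanti.le_of_tendsto hulim n)
  have hℓpos : 0 < ℓ := by linarith
  have hmono : Monotone x := monotone_nat_of_le_succ fun n => by
    refine le_of_mul_le_mul_left ((hu n).trans ?_) hℓpos
    exact mul_le_mul_of_nonneg_right hle (hx _).le
  exact (hx 0).not_ge (hmono.ge_of_tendsto hlim 0)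

/-! ### The bases -/

namespace QBDRates

variable {N : Type*} {M : ℕ} (C : QBDRates N M) (m : Fin (M + 1))

theorem alphaTot_nonneg : 0 ≤ C.alphaTot m :=
  Finset.sum_nonneg fun _ _ => Finset.sum_nonneg fun _ _ => NNReal.coe_nonneg _

theorem discriminant_nonneg :
    0 ≤ (C.alphaTot m + C.lam m + C.mu m) ^ 2 - 4 * C.lam m * C.mu m := by
  nlinarith [sq_nonneg ((C.lam m : ℝ) - C.mu m), C.alphaTot_nonneg m,
    mul_nonneg (C.alphaTot_nonneg m) (C.lam m).coe_nonneg,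
    mul_nonneg (C.alphaTot_nonneg m) (C.mu m).coe_nonneg]

theorem phi_nonneg : 0 ≤ C.phi m (C.alphaTot m) := by
  have h0 := C.alphaTot_nonneg m
  refine div_nonneg (sub_nonneg.2 (Real.sqrt_le_iff.2 ⟨by positivity, ?_⟩)) (by positivity)
  have : (0 : ℝ) ≤ C.lam m * C.mu m := by positivity
  linarith

theorem phi_le_one : C.phi m (C.alphaTot m) ≤ 1 := by
  have h0 := C.alphaTot_nonneg m
  refine div_le_one_of_le₀ ?_ (by positivity)
  have : C.alphaTot m + C.mu m - C.lam m ≤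
      √((C.alphaTot m + C.lam m + C.mu m) ^ 2 - 4 * C.lam m * C.mu m) := by
    refine Real.le_sqrt_of_sq_le ?_
    nlinarith [mul_nonneg h0 (C.lam m).coe_nonneg]
  linarith

/-- This also holds for `μ_m = 0`, where `φ_m = 0`, and for `λ_m = 0`, where `r_m = 0`. -/
theorem mu_mul_base : C.mu m * C.base m = C.lam m * C.phi m (C.alphaTot m) := by
  unfold base
  split_ifs with hmu
  · have : (C.mu m : ℝ) ≠ 0 := by exact_mod_cast hmu.ne'
    field_simp
  · have : C.mu m = 0 := by simpa using hmu
    have h0 : 0 ≤ C.alphaTot m + C.lam m := add_nonneg (C.alphaTot_nonneg m) (NNReal.coe_nonneg _)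
    simp [this, phi, Real.sqrt_sq h0]

theorem mu_mul_base_le : C.mu m * C.base m ≤ C.lam m := by
  rw [mu_mul_base]
  exact mul_le_of_le_one_right (NNReal.coe_nonneg _) (C.phi_le_one m)

theorem base_eq_zero_iff : C.base m = 0 ↔ C.lam m = 0 := by
  refine ⟨fun h => ?_, fun h => by simp [base, h]⟩
  by_contra hlam
  have hl : (0 : ℝ) < C.lam m := by exact_mod_cast pos_iff_ne_zero.2 hlam
  have h0 := C.alphaTot_nonneg m
  unfold base at h
  split_ifs at h with hmu
  · have hm : (0 : ℝ) < C.mu m := by exact_mod_cast hmu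
    refine (mul_pos (div_pos hl hm) (div_pos (sub_pos.2 ?_) (by positivity))).ne' h
    rw [Real.sqrt_lt' (by positivity)]
    nlinarith [mul_pos hl hm]
  · exact (div_pos hl (by positivity)).ne' h

theorem base_quadratic :
    C.mu m * C.base m ^ 2 - (C.lam m + C.mu m + C.alphaTot m) * C.base m + C.lam m = 0 := by
  by_cases hlam : C.lam m = 0
  · simp [(C.base_eq_zero_iff m).2 hlam, hlam]
  have hl : (0 : ℝ) < C.lam m := by exact_mod_cast pos_iff_ne_zero.2 hlam
  have h0 := C.alphaTot_nonneg m
  unfold base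
  split_ifs with hmu
  · have hm : (0 : ℝ) < C.mu m := by exact_mod_cast hmu
    unfold phi
    have hs := Real.sq_sqrt (C.discriminant_nonneg m)
    set s := √((C.alphaTot m + C.lam m + C.mu m) ^ 2 - 4 * C.lam m * C.mu m)
    field_simp
    linear_combination hs
  · have : C.mu m = 0 := by simpa using hmu
    have h1 : (C.lam m + C.alphaTot m : ℝ) ≠ 0 := by positivity
    simp only [this, NNReal.coe_zero]
    field_simp
    ring

theorem base_nonneg : 0 ≤ C.base m := by
  unfold base
  have := C.phi_nonneg m
  have := C.alphaTot_nonneg m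
  split_ifs <;> positivity

/-- The factorization of the characteristic polynomial of phase `m`, with roots `r_m` and
`1 / φ_m(α_m)`, multiplied by `r_m` so that it needs no division. -/
theorem charPoly_mul_base (z : ℝ) :
    (C.mu m * z ^ 2 - (C.lam m + C.mu m + C.alphaTot m) * z + C.lam m) * C.base m =
      C.lam m * (C.base m - z) * (1 - C.phi m (C.alphaTot m) * z) := by
  linear_combination (z ^ 2 - C.base m * z) * C.mu_mul_base m + z * C.base_quadratic m

/-- What ergodicity gives for the rates: no state above the lowest level is absorbing, and
a phase without exits to other phases drifts downwards. -/
structure IsStable : Prop where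
  pos : ∀ m, 0 < C.lam m + C.mu m + C.alphaTot m
  lam_lt_mu : ∀ m, C.alphaTot m = 0 → C.lam m < C.mu m

variable {C}

theorem IsStable.base_lt_one (h : C.IsStable) : C.base m < 1 := by
  have h0 := C.alphaTot_nonneg m
  by_cases hlam : C.lam m = 0
  · rw [(C.base_eq_zero_iff m).2 hlam]; exact one_pos
  have hl : (0 : ℝ) < C.lam m := by exact_mod_cast pos_iff_ne_zero.2 hlam
  have hdrift : C.alphaTot m = 0 → (C.lam m : ℝ) < C.mu m := fun h1 => by
    exact_mod_cast h.lam_lt_mu m h1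
  by_contra! hge
  -- The quadratic equation says `(λ - μ r) (1 - r) = α r`, whose sides have different signs.
  have h1 := C.base_quadratic m
  have h2 := C.mu_mul_base_le m
  have h3 : (C.mu m : ℝ) ≤ C.lam m := le_trans (le_mul_of_one_le_right (C.mu m).coe_nonneg hge) h2
  have h4 : 0 < C.alphaTot m := h0.lt_of_ne fun h5 => (hdrift h5.symm).not_ge h3
  nlinarith [mul_nonneg (sub_nonneg.2 h2) (sub_nonneg.2 hge)]

end QBDRates

/-! ### The coefficients -/

namespace QBDRates

variable {N : Type*} {M : ℕ} (C : QBDRates N M)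

/-- The sum `∑_{i=k}^{m-1} ∑_Δ c_i α_i⟨m - i⟩⟨Δ⟩ r_k^{-Δ}` for given numbers `c_i`. -/
noncomputable def inflowSum (m k : Fin (M + 1)) (c : Fin (M + 1) → ℝ) : ℝ :=
  ∑ i ∈ Finset.Ico k m, ∑ Δ ∈ Finset.Icc (-1 : ℤ) 1,
    ((C.alpha i m Δ : ℝ) * C.base k ^ (-Δ)) * c i

/-- The coefficient `c_{m,k}`, `k < m`, in terms of the numbers `c_i = c_{i,k}` for `i < m`. -/
noncomputable def offDiagCoeff (m k : Fin (M + 1)) (c : Fin (M + 1) → ℝ) : ℝ :=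
  if C.base k = 0 then 0
  else if C.base m = 0 then
    ((C.mu m : ℝ) * (1 - C.base k) + C.alphaTot m)⁻¹ * C.inflowSum m k c
  else
    (C.base k * C.base m /
      (C.lam m * (C.base k - C.base m) * (1 - C.phi m (C.alphaTot m) * C.base k))) *
        C.inflowSum m k c

/-- The coefficients `c_{m,k}`, by recursion on `m`, for given probabilities `p m` of the states
`(m, j₀)`. They are `0` for `k > m`.
The conditions `i < m` serve the termination of the recursion only. -/
noncomputable def coeff (p : Fin (M + 1) → ℝ) (m k : Fin (M + 1)) : ℝ :=
  if k < m then C.offDiagCoeff m k fun i => if _ : i < m then coeff p i k else 0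
  else if k = m then
    p m - ∑ l ∈ Finset.Iio m, C.offDiagCoeff m l fun i => if _ : i < m then coeff p i l else 0
  else 0
termination_by m

theorem offDiagCoeff_dite (m k : Fin (M + 1)) (c : Fin (M + 1) → ℝ) :
    (C.offDiagCoeff m k fun i => if _ : i < m then c i else 0) = C.offDiagCoeff m k c := by
  have : (C.inflowSum m k fun i => if _ : i < m then c i else 0) = C.inflowSum m k c := by
    refine Finset.sum_congr rfl fun i hi => ?_
    simp [(Finset.mem_Ico.1 hi).2]
  simp only [offDiagCoeff, this]

theorem coeff_of_lt (p : Fin (M + 1) → ℝ) {m k : Fin (M + 1)} (hk : k < m) :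
    C.coeff p m k = C.offDiagCoeff m k fun i => C.coeff p i k := by
  rw [coeff, if_pos hk, offDiagCoeff_dite C m k fun i => C.coeff p i k]

theorem coeff_self (p : Fin (M + 1) → ℝ) (m : Fin (M + 1)) :
    C.coeff p m m = p m - ∑ l ∈ Finset.Iio m, C.coeff p m l := by
  rw [coeff, if_neg (lt_irrefl m), if_pos rfl]
  congr 1
  refine Finset.sum_congr rfl fun l hl => ?_
  rw [offDiagCoeff_dite C m l fun i => C.coeff p i l, coeff_of_lt C p (Finset.mem_Iio.1 hl)]

theorem coeff_of_lt_of_base_eq_zero (p : Fin (M + 1) → ℝ) {m k : Fin (M + 1)} (hk : k < m)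
    (hr : C.base k = 0) : C.coeff p m k = 0 := by
  rw [coeff_of_lt C p hk, offDiagCoeff, if_pos hr]

variable {C}

/-- `c_{m,k} r_k^n` solves the recurrence of phase `m` whose inhomogeneity is the inflow due to the
terms with base `r_k` in the lower phases. -/
theorem offDiagCoeff_mul_charPoly (h : C.IsStable)
    (hdistinct : ∀ m i : Fin (M + 1), C.base m = C.base i → m = i ∨ C.base m = 0)
    {m k : Fin (M + 1)} (hk : k < m) (hr : C.base k ≠ 0) (c : Fin (M + 1) → ℝ) :
    C.offDiagCoeff m k c * (C.mu m * C.base k ^ 2 -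
      (C.lam m + C.mu m + C.alphaTot m) * C.base k + C.lam m) =
        -(C.base k * C.inflowSum m k c) := by
  have hk1 := h.base_lt_one k
  have hk0 := (C.base_nonneg k).lt_of_ne' hr
  rw [offDiagCoeff, if_neg hr]
  split_ifs with hm
  · have hlam := (C.base_eq_zero_iff m).1 hm
    have hpos := h.pos m
    simp only [hlam, NNReal.coe_zero, zero_add, add_zero] at hpos ⊢
    have hden : C.mu m * (1 - C.base k) + C.alphaTot m ≠ 0 := by
      have h0 := C.alphaTot_nonneg m
      have h1 : 0 ≤ C.mu m * C.base k := by positivity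
      rcases (C.mu m).coe_nonneg.eq_or_lt with h2 | h2
      · rw [← h2] at hpos ⊢
        simpa using hpos.ne'
      · exact (add_pos_of_pos_of_nonneg (mul_pos h2 (sub_pos.2 hk1)) h0).ne'
    field_simp
    ring
  · have hlam : (C.lam m : ℝ) ≠ 0 := by exact_mod_cast fun h0 => hm ((C.base_eq_zero_iff m).2 h0)
    have h1 : C.base k - C.base m ≠ 0 := by
      refine sub_ne_zero.2 fun h0 => ?_
      rcases hdistinct k m h0 with h2 | h2
      · exact hk.ne h2
      · exact hr h2
    have h2 : 1 - C.phi m (C.alphaTot m) * C.base k ≠ 0 := by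
      have := mul_le_mul_of_nonneg_right (C.phi_le_one m) hk0.le
      rw [one_mul] at this
      exact (sub_pos.2 (this.trans_lt hk1)).ne'
    have h3 := C.charPoly_mul_base m (C.base k)
    rw [div_mul_eq_mul_div, div_mul_eq_mul_div, div_eq_iff (by
      exact mul_ne_zero (mul_ne_zero hlam h1) h2)]
    linear_combination (C.base k * C.inflowSum m k c) * h3

/-- The contributions of base `r_k` to the inflow into `(m, j₀ + n + 1)` from lower phases. For
`r_k = 0` they could be nonzero only through `0 ^ 0`, that is, through the transitions
`(k, j₀) → (m, j₀ + 1)`, which `hup` excludes. -/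
theorem sum_inflow_eq {p : Fin (M + 1) → ℝ} {m k : Fin (M + 1)}
    (hup : ∀ i m : Fin (M + 1), i < m → C.lam i = 0 → C.alpha i m 1 = 0) (hk : k < m) (n : ℕ) :
    ∑ i ∈ Finset.Ico k m, (C.alpha i m (-1) * (C.coeff p i k * C.base k ^ (n + 2)) +
      C.alpha i m 0 * (C.coeff p i k * C.base k ^ (n + 1)) +
        C.alpha i m 1 * (C.coeff p i k * C.base k ^ n)) =
      if C.base k = 0 then 0
        else C.base k ^ (n + 1) * C.inflowSum m k fun i => C.coeff p i k := by
  split_ifs with hr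
  · refine Finset.sum_eq_zero fun i hi => ?_
    rw [Finset.mem_Ico] at hi
    rcases hi.1.eq_or_lt with rfl | hki
    · simp [hr, hup k m hk ((C.base_eq_zero_iff k).1 hr)]
    · simp [C.coeff_of_lt_of_base_eq_zero p hki hr]
  · rw [inflowSum, Finset.mul_sum]
    refine Finset.sum_congr rfl fun i _ => ?_
    rw [sum_Icc_neg_one_one]
    simp only [neg_neg, zpow_one, neg_zero, zpow_zero, zpow_neg]
    field_simp
    ring

variable {x : Fin (M + 1) → ℕ → ℝ}

/-- The solution of the balance equations above the lowest level, phase by phase: the terms with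
the bases of lower phases solve the inhomogeneous recurrence of phase `m`, and what remains is a
null solution of the homogeneous recurrence, hence a multiple of `r_m^n`. -/
theorem eq_sum_coeff (h : C.IsStable)
    (hdistinct : ∀ m i : Fin (M + 1), C.base m = C.base i → m = i ∨ C.base m = 0)
    (hup : ∀ i m : Fin (M + 1), i < m → C.lam i = 0 → C.alpha i m 1 = 0)
    (hbal : ∀ m n, x m (n + 1) * (C.lam m + C.mu m + C.alphaTot m) =
      C.lam m * x m n + C.mu m * x m (n + 2) + ∑ i ∈ Finset.Iio m,
        (C.alpha i m (-1) * x i (n + 2) + C.alpha i m 0 * x i (n + 1) + C.alpha i m 1 * x i n))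
    (hlim : ∀ m, Tendsto (x m) atTop (𝓝 0)) (m : Fin (M + 1)) (n : ℕ) :
    x m n = ∑ k ∈ Finset.Iic m, C.coeff (fun i => x i 0) m k * C.base k ^ n := by
  induction m using WellFoundedLT.induction generalizing n with
  | ind m ih =>
  set c := C.coeff fun i => x i 0 with hc
  let e : ℕ → ℝ := fun n => x m n - ∑ k ∈ Finset.Iio m, c m k * C.base k ^ n
  have hinflow (n : ℕ) : ∑ i ∈ Finset.Iio m, (C.alpha i m (-1) * x i (n + 2) +
      C.alpha i m 0 * x i (n + 1) + C.alpha i m 1 * x i n) = ∑ k ∈ Finset.Iio m,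
        if C.base k = 0 then 0 else C.base k ^ (n + 1) * C.inflowSum m k fun i => c i k := by
    rw [Finset.sum_congr rfl fun k hk =>
      (sum_inflow_eq (p := fun i => x i 0) hup (Finset.mem_Iio.1 hk) n).symm]
    rw [Finset.sum_comm' (t' := Finset.Iio m) (s' := Finset.Iic) (by
      intro k i
      simp only [Finset.mem_Iio, Finset.mem_Ico, Finset.mem_Iic]
      exact ⟨fun h => h.2, fun h => ⟨h.1.trans_lt h.2, h⟩⟩)]
    refine Finset.sum_congr rfl fun i hi => ?_
    have hi' := Finset.mem_Iio.1 hi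
    rw [ih i hi' n, ih i hi' (n + 1), ih i hi' (n + 2), Finset.mul_sum, Finset.mul_sum,
      Finset.mul_sum, ← Finset.sum_add_distrib, ← Finset.sum_add_distrib]
  have hpart (n : ℕ) : ∑ k ∈ Finset.Iio m, (c m k * C.base k ^ n * (C.mu m * C.base k ^ 2 -
      (C.lam m + C.mu m + C.alphaTot m) * C.base k + C.lam m) +
        if C.base k = 0 then 0 else C.base k ^ (n + 1) * C.inflowSum m k fun i => c i k) = 0 := by
    refine Finset.sum_eq_zero fun k hk => ?_
    have hk' := Finset.mem_Iio.1 hk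
    split_ifs with hr
    · simp [hc, C.coeff_of_lt_of_base_eq_zero _ hk' hr]
    · have h1 := offDiagCoeff_mul_charPoly h hdistinct hk' hr fun i => c i k
      rw [← C.coeff_of_lt _ hk', ← hc] at h1
      linear_combination C.base k ^ n * h1
  have hrec (n : ℕ) : C.mu m * e (n + 2) - (C.lam m + C.mu m + C.alphaTot m) * e (n + 1) +
      C.lam m * e n = 0 := by
    have h1 := hbal m n
    have h2 := hpart n
    rw [hinflow] at h1
    rw [Finset.sum_add_distrib] at h2
    have h3 : ∑ k ∈ Finset.Iio m, c m k * C.base k ^ n * (C.mu m * C.base k ^ 2 -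
        (C.lam m + C.mu m + C.alphaTot m) * C.base k + C.lam m) =
        C.mu m * ∑ k ∈ Finset.Iio m, c m k * C.base k ^ (n + 2) -
          (C.lam m + C.mu m + C.alphaTot m) * ∑ k ∈ Finset.Iio m, c m k * C.base k ^ (n + 1) +
            C.lam m * ∑ k ∈ Finset.Iio m, c m k * C.base k ^ n := by
      rw [Finset.mul_sum, Finset.mul_sum, Finset.mul_sum, ← Finset.sum_sub_distrib,
        ← Finset.sum_add_distrib]
      exact Finset.sum_congr rfl fun k _ => by ring
    simp only [e]
    linear_combination -h1 - h2 + h3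
  have helim : Tendsto e atTop (𝓝 0) := by
    have h1 : Tendsto (fun n => ∑ k ∈ Finset.Iio m, c m k * C.base k ^ n) atTop (𝓝 0) := by
      simpa using tendsto_finsetSum (Finset.Iio m) fun k _ =>
        (tendsto_pow_atTop_nhds_zero_of_lt_one (C.base_nonneg k) (h.base_lt_one k)).const_mul
          (c m k)
    simpa using (hlim m).sub h1
  have hle := C.mu_mul_base_le m
  have hα := C.alphaTot_nonneg m
  have hpos : 0 < C.lam m + C.mu m + C.alphaTot m - C.mu m * C.base m := by
    rcases (C.mu m).coe_nonneg.eq_or_lt with h0 | h0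
    · have := h.pos m
      rw [← h0] at this ⊢
      linarith
    · linarith
  have hgeom := eq_pow_mul_of_recurrence (C.base_quadratic m) (C.mu m).coe_nonneg (by linarith)
    hpos hrec helim n
  have he0 : e 0 = c m m := by
    rw [hc, C.coeff_self]
    simp [e, hc]
  rw [he0] at hgeom
  rw [← Finset.Iio_insert, Finset.sum_insert (by simp)]
  linear_combination hgeom

end QBDRates

/-! ### The linear system -/

namespace QBDRates

variable {N : Type*} {M : ℕ} {C : QBDRates N M} {j₀ : ℕ} {π : QBDState N M j₀ → ℝ}

theorem tendsto_level (hπ : Summable π) (m : Fin (M + 1)) :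
    Tendsto (fun n => π (.inr (m, levelEquiv j₀ n))) atTop (𝓝 0) := by
  refine Summable.tendsto_atTop_zero (hπ.comp_injective (i := fun n => .inr (m, levelEquiv j₀ n))
    fun n l hnl => ?_)
  simpa using hnl

/-- A phase without exits has to drift downwards, because the stationary probabilities of its
levels are summable. -/
theorem isStable [Fintype N] (hirr : CTMC.IsIrreducible (C.rate j₀))
    (hπ : CTMC.IsStationary (C.rate j₀) π) :
    C.IsStable := by
  obtain ⟨Λ, hΛ⟩ := C.exists_isUniformizable j₀
  have hpos (m : Fin (M + 1)) : 0 < C.lam m + C.mu m + C.alphaTot m := by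
    rw [← sojournRate_succ (j₀ := j₀) m 0]
    exact_mod_cast hΛ.sojournRate_pos hirr _
  refine ⟨hpos, fun m hm => ?_⟩
  have hpos' := hpos m
  rw [hm, add_zero] at hpos'
  let g : ℕ → ℝ := fun n => ∑ i ∈ Finset.Iio m,
    (C.alpha i m (-1) * π (.inr (i, levelEquiv j₀ (n + 2))) +
      C.alpha i m 0 * π (.inr (i, levelEquiv j₀ (n + 1))) +
        C.alpha i m 1 * π (.inr (i, levelEquiv j₀ n)))
  have hg (n : ℕ) : 0 ≤ g n := by
    refine Finset.sum_nonneg fun i _ => ?_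
    have h1 := (hπ.pos (.inr (i, levelEquiv j₀ (n + 2)))).le
    have h2 := (hπ.pos (.inr (i, levelEquiv j₀ (n + 1)))).le
    have h3 := (hπ.pos (.inr (i, levelEquiv j₀ n))).le
    positivity
  refine NNReal.coe_lt_coe.1 (lt_of_recurrence (g := g) hpos'
    (fun n => hπ.pos (.inr (m, levelEquiv j₀ n))) hg (fun n => ?_)
    (tendsto_level hπ.hasSum_one.summable m))
  have := balance_succ hπ.balance m n
  rwa [hm, add_zero] at this

end QBDRates

namespace CAP

variable {N : Type*} {M : ℕ} {j₀ : ℕ}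

section Values

variable (c : Fin (M + 1) → Fin (M + 1) → ℝ) (π : QBDState N M j₀ → ℝ)

theorem cVar_values {m k : Fin (M + 1)} (h : k ≤ m) : cVar N m k (values c π) = c m k := by
  simp [cVar, h, values]

theorem levelVar_values (m : Fin (M + 1)) :
    levelVar N m (values c π) = π (.inr (m, QBDRates.levelEquiv j₀ 0)) := rfl

theorem nonrepVar_values (x : N) : nonrepVar M x (values c π) = π (.inl x) := rfl

theorem inflow_values (C : QBDRates N M) (m k : Fin (M + 1)) :
    inflow C m k (values c π) = C.inflowSum m k fun i => c i k := by
  simp only [inflow, QBDRates.inflowSum, LinearMap.sum_apply, LinearMap.smul_apply, smul_eq_mul]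
  refine Finset.sum_congr rfl fun i hi => Finset.sum_congr rfl fun Δ _ => ?_
  rw [cVar_values c π (Finset.mem_Ico.1 hi).1]

theorem nextLevel_values (C : QBDRates N M) (m : Fin (M + 1)) :
    nextLevel C m (values c π) = ∑ k ∈ Finset.Iic m, c m k * C.base k := by
  simp only [nextLevel, LinearMap.sum_apply, LinearMap.smul_apply, smul_eq_mul]
  refine Finset.sum_congr rfl fun k hk => ?_
  rw [cVar_values c π (Finset.mem_Iic.1 hk), mul_comm]

theorem offDiag_values [Fintype N] (C : QBDRates N M) {m k : Fin (M + 1)} (h : k < m) :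
    rhs C (.offDiag m k h) (values c π) = C.offDiagCoeff m k fun i => c i k := by
  simp only [rhs, QBDRates.offDiagCoeff]
  split_ifs <;> simp [inflow_values]

end Values

/-- The linear system consists of the recursion for the coefficients, of the balance equations at
the lowest level and of the nonrepeating states (divided by the sojourn rates), and of the total
mass summed by geometric series. -/
theorem isSolution_coeff [Fintype N] {C : QBDRates N M} {π : QBDState N M j₀ → ℝ}
    (hpos : ∀ x, 0 < CTMC.sojournRate (C.rate j₀) x) (hπ : CTMC.IsStationary (C.rate j₀) π)
    (hstable : C.IsStable)
    (hform : ∀ m n, π (.inr (m, QBDRates.levelEquiv j₀ n)) = ∑ k ∈ Finset.Iic m,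
      C.coeff (fun i => π (.inr (i, QBDRates.levelEquiv j₀ 0))) m k * C.base k ^ n) :
    IsSolution C
      (values (C.coeff fun i => π (.inr (i, QBDRates.levelEquiv j₀ 0))) π) := by
  set c := C.coeff fun i => π (.inr (i, QBDRates.levelEquiv j₀ 0)) with hc
  have hnext (m : Fin (M + 1)) :
      ∑ k ∈ Finset.Iic m, c m k * C.base k = π (.inr (m, QBDRates.levelEquiv j₀ 1)) := by
    simp [hform m 1]
  have hpos' (x : QBDState N M j₀) : (CTMC.sojournRate (C.rate j₀) x : ℝ) ≠ 0 := by
    exact_mod_cast (hpos x).ne'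
  rintro (⟨m, k, hk⟩ | m | m | x | _)
  · rw [offDiag_values]
    simp only [lhs, const, add_zero, cVar_values c π hk.le]
    exact C.coeff_of_lt _ hk
  · simp only [lhs, rhs, const, add_zero, cVar_values c π le_rfl, LinearMap.sub_apply,
      LinearMap.sum_apply, levelVar_values]
    rw [hc, C.coeff_self]
    congr 1
    exact Finset.sum_congr rfl fun k hk => (cVar_values _ π (Finset.mem_Iio.1 hk).le).symm
  · have h := QBDRates.balance_zero hπ.balance m
    simp only [lhs, rhs, const, add_zero, LinearMap.smul_apply, LinearMap.add_apply,
      LinearMap.sum_apply, smul_eq_mul, levelVar_values, nonrepVar_values, nextLevel_values, hnext]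
    rw [← h, ← QBDRates.sojournRate_zero (j₀ := j₀), mul_comm (π _),
      inv_mul_cancel_left₀ (hpos' _)]
  · have h := QBDRates.balance_inl hπ.balance x
    simp only [lhs, rhs, const, add_zero, LinearMap.smul_apply, LinearMap.add_apply,
      LinearMap.sum_apply, smul_eq_mul, levelVar_values, nonrepVar_values]
    rw [← h, ← QBDRates.sojournRate_inl (j₀ := j₀), mul_comm (π _),
      inv_mul_cancel_left₀ (hpos' _)]
  · simp only [lhs, rhs, const, LinearMap.zero_apply, zero_add, LinearMap.add_apply,
      LinearMap.sum_apply, LinearMap.smul_apply, smul_eq_mul, nonrepVar_values]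
    refine QBDRates.hasSum_eq_of_fibers hπ.hasSum_one fun m => ?_
    simp only [hform m]
    refine hasSum_sum fun k hk => ?_
    rw [cVar_values c π (Finset.mem_Iic.1 hk), mul_comm]
    exact (hasSum_geometric_of_lt_one (C.base_nonneg k) (hstable.base_lt_one k)).mul_left _

/-! ### The number of unknowns and of equations -/

section Card

variable (N : Type*) (M : ℕ)

theorem card_pairs_le :
    Fintype.card {p : Fin (M + 1) × Fin (M + 1) // p.2 ≤ p.1} * 2 = (M + 1) * (M + 2) := by
  rw [Fintype.card_congr (Equiv.subtypeProdEquivSigmaSubtype fun a b : Fin (M + 1) => b ≤ a),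
    Fintype.card_sigma]
  have h (m : Fin (M + 1)) : Fintype.card {k : Fin (M + 1) // k ≤ m} = m.1 + 1 := by
    rw [Fintype.card_subtype, Finset.filter_ge_eq_Iic, Fin.card_Iic]
  simp only [h]
  have := Finset.sum_range_id_mul_two (M + 2)
  rw [Fin.sum_univ_eq_sum_range (fun i => i + 1) (M + 1)]
  rw [Finset.sum_range_succ'] at this
  simpa [mul_comm] using this

theorem card_pairs_lt :
    Fintype.card {p : Fin (M + 1) × Fin (M + 1) // p.2 < p.1} * 2 = (M + 1) * M := by
  rw [Fintype.card_congr (Equiv.subtypeProdEquivSigmaSubtype fun a b : Fin (M + 1) => b < a),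
    Fintype.card_sigma]
  have h (m : Fin (M + 1)) : Fintype.card {k : Fin (M + 1) // k < m} = m.1 := by
    rw [Fintype.card_subtype, Finset.filter_gt_eq_Iio, Fin.card_Iio]
  simp only [h]
  rw [Fin.sum_univ_eq_sum_range (fun i => i) (M + 1), Finset.sum_range_id_mul_two]
  simp

theorem card_unknown [Fintype N] :
    Nat.card (Unknown N M) = M * (M + 5) / 2 + Fintype.card N + 2 := by
  have h := card_pairs_le M
  have h2 : (M + 1) * (M + 2) = M * (M + 5) - 2 * M + 2 := by
    have : M * (M + 5) = M * M + 5 * M := by ring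
    have : (M + 1) * (M + 2) = M * M + 3 * M + 2 := by ring
    omega
  have h3 : 2 * M ≤ M * (M + 5) := by nlinarith
  rw [Nat.card_eq_fintype_card, Fintype.card_sum, Fintype.card_sum, Fintype.card_fin]
  omega

/-- The equations, grouped by kind. -/
def equationEquiv : Equation N M ≃
    {p : Fin (M + 1) × Fin (M + 1) // p.2 < p.1} ⊕ (Fin (M + 1) ⊕ (Fin (M + 1) ⊕ (N ⊕ Unit))) where
  toFun
    | .offDiag m k h => .inl ⟨(m, k), h⟩
    | .diag m => .inr (.inl m)
    | .level m => .inr (.inr (.inl m))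
    | .nonrep x => .inr (.inr (.inr (.inl x)))
    | .norm => .inr (.inr (.inr (.inr ())))
  invFun
    | .inl p => .offDiag p.1.1 p.1.2 p.2
    | .inr (.inl m) => .diag m
    | .inr (.inr (.inl m)) => .level m
    | .inr (.inr (.inr (.inl x))) => .nonrep x
    | .inr (.inr (.inr (.inr _))) => .norm
  left_inv e := by cases e <;> rfl
  right_inv e := by rcases e with _ | _ | _ | _ | _ <;> rfl

theorem card_equation [Fintype N] :
    Nat.card (Equation N M) = M * (M + 5) / 2 + Fintype.card N + 3 := by
  have h := card_pairs_lt M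
  have h2 : (M + 1) * M + 4 * M = M * (M + 5) := by ring
  rw [Nat.card_congr (equationEquiv N M), Nat.card_eq_fintype_card, Fintype.card_sum,
    Fintype.card_sum, Fintype.card_sum, Fintype.card_sum, Fintype.card_fin, Fintype.card_unit]
  omega

end Card

end CAP

theorem theorem3 {N : Type*} [Fintype N] (M j₀ : ℕ) (C : QBDRates N M)
    (hergodic : CTMC.IsErgodic (C.rate j₀))
    (hdistinct : ∀ m i : Fin (M + 1), C.base m = C.base i → m = i ∨ C.base m = 0)
    (hup : ∀ i m : Fin (M + 1), i < m → C.lam i = 0 → C.alpha i m 1 = 0) :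
    (∃ π : QBDState N M j₀ → ℝ, CTMC.IsLimitingDistribution (C.rate j₀) π ∧
      ∃ c : Fin (M + 1) → Fin (M + 1) → ℝ,
        (∀ (m : Fin (M + 1)) (j : {j : ℕ // j₀ ≤ j}), j₀ + 1 ≤ j.1 →
          π (Sum.inr (m, j)) = ∑ k ∈ Finset.Iic m, c m k * C.base k ^ (j.1 - j₀)) ∧
        CAP.IsSolution C (CAP.values c π)) ∧
    Nat.card (CAP.Unknown N M) = M * (M + 5) / 2 + Fintype.card N + 2 ∧
    Nat.card (CAP.Equation N M) = M * (M + 5) / 2 + Fintype.card N + 3 := by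
  refine ⟨?_, CAP.card_unknown N M, CAP.card_equation N M⟩
  obtain ⟨Λ, hΛ⟩ := C.exists_isUniformizable j₀
  obtain ⟨π, hπ⟩ := hergodic.exists_isStationary hΛ
  have hirr := hergodic.irreducible
  have hstable := QBDRates.isStable hirr hπ
  have hform := QBDRates.eq_sum_coeff hstable hdistinct hup
    (QBDRates.balance_succ hπ.balance) (QBDRates.tendsto_level hπ.hasSum_one.summable)
  refine ⟨π, hπ.isLimitingDistribution hΛ hirr, _, fun m j _ => ?_,
    CAP.isSolution_coeff (hΛ.sojournRate_pos hirr) hπ hstable hform⟩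
  obtain ⟨n, rfl⟩ := (QBDRates.levelEquiv j₀).surjective j
  rw [hform m n, QBDRates.coe_levelEquiv, Nat.add_sub_cancel_left]
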